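/- Let $M$ be a smooth $m$-dimensional Riemannian manifold (Hausdorff, second countable, without boundary; neither completeness nor orientability is assumed) with Riemannian volume measure $dV_M$. Let $1<p<\infty$ and let $q=p/(p-1)$ be its conjugate exponent. Let $f:M\to[0,\infty)$ be a continuous exhaustion function (that is, $\{f\le c\}$ is compact for every $c\in\mathbb R$) which belongs to $W^{1,p}_{\mathrm{loc}}(M)$, with weak gradient $\nabla f$. For $r>0$ put \[ C(r)=f^{-1}[0,2r)\setminus f^{-1}[0,r). \] Let $X\in L^q_{\mathrm{loc}}(M)$ be a vector field which has a weak divergence $\operatorname{div}X\in L^1_{\mathrm{loc}}(M)$, i.e. \[ \int_M \varphi\,\operatorname{div}X\,dV_M=-\int_M\langle\nabla\varphi,X\rangle\,dV_M\qquad\text{for all }\varphi\in C_c^\infty(M), \] and assume that $(\operatorname{div}X)_-=\max\{-\operatorname{div}X,0\}\in L^1(M)$. If $X$ satisfies the condition $\mathcal E_{M,p}$: \[ \liminf_{r\to\infty}\frac1r\left(\int_{C(r)}|\nabla f|^p\,dV_M\right)^{1/p}\left(\int_{C(r)}|X|^{q}\,dV_M\right)^{1/q}=0, \] then $\operatorname{div}X\in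 L^1(M)$ and $\int_M\operatorname{div}X\,dV_M=0$. -/

import Mathlib

open Bundle MeasureTheory Set Filter Topology
open scoped Bundle Manifold ContDiff ENNReal

noncomputable section

namespace KarpStokes

section

variable {m : ℕ} {M : Type*} [TopologicalSpace M] [ChartedSpace (EuclideanSpace ℝ (Fin m)) M]

/-- The coordinate vector field `∂ᵢ` of a chart `e`, at the point with coordinates `y`. -/
def coordField (e : OpenPartialHomeomorph M (EuclideanSpace ℝ (Fin m)))
    (y : EuclideanSpace ℝ (Fin m)) (i : Fin m) : TangentSpace (𝓡 m) (e.symm y) :=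
  mfderiv (𝓡 m) (𝓡 m) e.symm y (EuclideanSpace.single i (1 : ℝ) : EuclideanSpace ℝ (Fin m))

/-- The coordinate expression of a vector field `X` in a chart `e`, as a function on the
domain of the chart. -/
def coordExpr (e : OpenPartialHomeomorph M (EuclideanSpace ℝ (Fin m)))
    (X : ∀ x : M, TangentSpace (𝓡 m) x) (x : M) : EuclideanSpace ℝ (Fin m) :=
  mfderiv (𝓡 m) (𝓡 m) e x (X x)

variable [RiemannianBundle (fun x : M ↦ TangentSpace (𝓡 m) x)]

/-- The matrix `gᵢⱼ = ⟨∂ᵢ, ∂ⱼ⟩` of the Riemannian metric in a chart. -/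
def gramMatrix (e : OpenPartialHomeomorph M (EuclideanSpace ℝ (Fin m)))
    (y : EuclideanSpace ℝ (Fin m)) : Matrix (Fin m) (Fin m) ℝ :=
  Matrix.of fun i j ↦ inner ℝ (coordField e y i) (coordField e y j)

variable [MeasurableSpace M]

/-- The Riemannian volume of the domain of a chart: the measure `√(det g) dy`, transported
to the manifold by the inverse of the chart. It vanishes outside the domain of the chart. -/
def chartVolume (e : OpenPartialHomeomorph M (EuclideanSpace ℝ (Fin m))) : Measure M :=
  Measure.map e.symm ((volume.restrict e.target).withDensity
    fun y ↦ ENNReal.ofReal √(gramMatrix e y).det)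

variable (m M) in
/-- The Riemannian volume measure: the least measure which dominates `√(det g) dy` in every chart
of the smooth structure. Since the measures `√(det g) dy` of two charts agree where both charts
are defined, on the domain of a chart it coincides with `√(det g) dy`. -/
def riemannianVolume : Measure M :=
  ⨆ e ∈ IsManifold.maximalAtlas (𝓡 m) ∞ M, chartVolume (m := m) e

/-- The vector field `X` belongs to `L^q_loc`: its components in charts are measurable, and `|X|^q`
is locally integrable. -/
structure MemLpLoc (q : ℝ) (X : ∀ x : M, TangentSpace (𝓡 m) x) : Prop where
  aestronglyMeasurable : ∀ e ∈ IsManifold.maximalAtlas (𝓡 m) ∞ M,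
    AEStronglyMeasurable (coordExpr e X) ((riemannianVolume m M).restrict e.source)
  locallyIntegrable : LocallyIntegrable (fun x ↦ ‖X x‖ ^ q) (riemannianVolume m M)

/-- `G` is the weak gradient of `f`: in every chart, `⟨G, ∂ᵢ⟩` is the weak (distributional) partial
derivative `∂ᵢ f`. -/
def IsWeakGradient (f : M → ℝ) (G : ∀ x : M, TangentSpace (𝓡 m) x) : Prop :=
  ∀ e ∈ IsManifold.maximalAtlas (𝓡 m) ∞ M, ∀ ψ : EuclideanSpace ℝ (Fin m) → ℝ,
    ContDiff ℝ ∞ ψ → HasCompactSupport ψ → tsupport ψ ⊆ e.target → ∀ i : Fin m,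
      ∫ y in e.target, f (e.symm y) * fderiv ℝ ψ y (EuclideanSpace.single i (1 : ℝ)) =
        -∫ y in e.target, inner ℝ (G (e.symm y)) (coordField e y i) * ψ y

/-- `f ∈ W^{1,p}_loc(M)` with weak gradient `G`. -/
structure IsSobolevLoc (p : ℝ) (f : M → ℝ) (G : ∀ x : M, TangentSpace (𝓡 m) x) : Prop where
  aestronglyMeasurable : AEStronglyMeasurable f (riemannianVolume m M)
  locallyIntegrable : LocallyIntegrable (fun x ↦ |f x| ^ p) (riemannianVolume m M)
  isWeakGradient : IsWeakGradient f G
  memLpLoc : MemLpLoc p G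

/-- The function `h ∈ L^1_loc(M)` is the weak divergence of `X`: for every smooth compactly supported
function `φ` one has `∫ φ h dV = - ∫ ⟨∇φ, X⟩ dV`, where `⟨∇φ, X⟩ = dφ(X)`. -/
structure IsWeakDivergence (X : ∀ x : M, TangentSpace (𝓡 m) x) (h : M → ℝ) : Prop where
  locallyIntegrable : LocallyIntegrable h (riemannianVolume m M)
  integral_mul_eq : ∀ φ : M → ℝ, ContMDiff (𝓡 m) 𝓘(ℝ, ℝ) ∞ φ → HasCompactSupport φ →
    ∫ x, φ x * h x ∂(riemannianVolume m M) =
      -∫ x, (mfderiv (𝓡 m) 𝓘(ℝ, ℝ) φ x (X x) : ℝ) ∂(riemannianVolume m M)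

/-- A continuous exhaustion function `f : M → [0, ∞)`. -/
structure IsExhaustion {M : Type*} [TopologicalSpace M] (f : M → ℝ) : Prop where
  continuous : Continuous f
  nonneg : ∀ x, 0 ≤ f x
  isCompact_sublevel : ∀ c : ℝ, IsCompact {x | f x ≤ c}

/-- The set `C(r) = f⁻¹[0,2r) \ f⁻¹[0,r)`. -/
def shell {M : Type*} (f : M → ℝ) (r : ℝ) : Set M :=
  f ⁻¹' Ico 0 (2 * r) \ f ⁻¹' Ico 0 r

/-- The condition `𝓔_{M,p}` on `X`, for a function `f` with weak gradient `G`; here `q` is the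
exponent conjugate to `p`. The lower limit is taken in `[0, ∞]`. -/
def ConditionE (p q : ℝ) (f : M → ℝ) (G X : ∀ x : M, TangentSpace (𝓡 m) x) : Prop :=
  liminf (fun r : ℝ ↦ ENNReal.ofReal (1 / r) *
    (∫⁻ x in shell f r, ENNReal.ofReal (‖G x‖ ^ p) ∂(riemannianVolume m M)) ^ (1 / p) *
    (∫⁻ x in shell f r, ENNReal.ofReal (‖X x‖ ^ q) ∂(riemannianVolume m M)) ^ (1 / q))
    atTop = 0

end

end KarpStokes

end

/-! For smooth `Λ` vanishing beyond some level, `Λ ∘ f` is a compactly supported Sobolev function,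
and it may be used as a test function: `∫ Λ(f) div X = -∫ Λ'(f) ⟨∇f, X⟩` (`integral_comp_mul_eq`).
Take for `Λ` a cutoff which falls from 1 to 0 between `r` and `2r`. Then `Λ'` is `O(1/r)` and lives
on the shell `C(r)`, so Hölder bounds the right side by a constant times the quantity in condition
`𝓔`. Along suitable radii `r_k → ∞` the truncated integrals of `div X` therefore tend to 0. Since
`(div X)₋` is integrable, Fatou applied to `div X + (div X)₋` makes `div X` integrable, and
dominated convergence identifies its integral as 0 (`integrable_and_integral_eq_zero_of_tendsto`).

The bulk of the work is the integration by parts, because the weak divergence accepts only smooth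
test functions while `f` is merely continuous and `W^{1,p}_loc`. Locally one mollifies `f` in a
chart: the mollified functions converge pointwise by continuity of `f`, and their differentials
converge in `L^p` by Friedrichs' argument, which suffices against `X ∈ L^q`
(`IsChartNeighborhood.integral_mul_comp_mul_eq`). A finite partition of unity on a compact sublevel
set glues the local identities.

The weak gradient is expressed with Lebesgue measure in charts, the weak divergence with the
Riemannian volume. The two measures, and the two norms, must therefore be compared near each point;
this rests on the change of variables for `√(det g) dy` and on the continuity of the metric. -/

noncomputable section

namespace KarpStokes

/-! ### Mollification in `L^p` and Friedrichs approximation on a normed space. -/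

section Mollification

open scoped Convolution
open ContinuousLinearMap (lsmul)

variable {E : Type*} [NormedAddCommGroup E] [NormedSpace ℝ E] [FiniteDimensional ℝ E]
  [HasContDiffBump E] [MeasurableSpace E] [BorelSpace E] {μ : Measure E} [μ.IsAddHaarMeasure]
  {F : Type*} [NormedAddCommGroup F] [NormedSpace ℝ F]

omit [NormedSpace ℝ F] in
theorem memLp_indicator_of_restrict {α : Type*} {_ : MeasurableSpace α} {ν : Measure α}
    {s : Set α} (hs : MeasurableSet s) {r : ℝ≥0∞} {w : α → F} (hw : MemLp w r (ν.restrict s)) :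
    MemLp (s.indicator w) r ν :=
  (memLp_indicator_iff_restrict hs).2 hw

theorem lintegral_ofReal_normed (φ : ContDiffBump (0 : E)) :
    ∫⁻ t, ENNReal.ofReal (φ.normed μ t) ∂μ = 1 := by
  rw [← ofReal_integral_eq_lintegral_ofReal φ.integrable_normed
    (Eventually.of_forall φ.nonneg_normed), φ.integral_normed, ENNReal.ofReal_one]

/-- The normalized bump is a probability density, so monotonicity of `L^p` norms on a probability
space bounds the convolution pointwise. Tonelli and translation invariance then integrate the bound.
-/
theorem lintegral_enorm_normed_convolution_rpow_le (φ : ContDiffBump (0 : E)) {w : E → F}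
    (hw : AEStronglyMeasurable w μ) {p : ℝ} (hp : 1 ≤ p) :
    ∫⁻ x, ‖(φ.normed μ ⋆[lsmul ℝ ℝ, μ] w) x‖ₑ ^ p ∂μ ≤ ∫⁻ x, ‖w x‖ₑ ^ p ∂μ := by
  have hp0 : 0 < p := zero_lt_one.trans_le hp
  have hφm : Measurable (fun t ↦ ENNReal.ofReal (φ.normed μ t)) :=
    φ.continuous_normed.measurable.ennreal_ofReal
  set ρ : Measure E := μ.withDensity fun t ↦ ENNReal.ofReal (φ.normed μ t) with hρ
  have : IsProbabilityMeasure ρ := ⟨by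
    rw [hρ, withDensity_apply _ MeasurableSet.univ, setLIntegral_univ, lintegral_ofReal_normed]⟩
  have hshift : ∀ x, AEStronglyMeasurable (fun t ↦ w (x - t)) μ := fun x ↦
    hw.comp_quasiMeasurePreserving
      (quasiMeasurePreserving_sub_left_of_right_invariant μ x)
  have key : ∀ x, ‖(φ.normed μ ⋆[lsmul ℝ ℝ, μ] w) x‖ₑ ^ p ≤
      ∫⁻ t, ENNReal.ofReal (φ.normed μ t) * ‖w (x - t)‖ₑ ^ p ∂μ := by
    intro x
    have h1 : ‖(φ.normed μ ⋆[lsmul ℝ ℝ, μ] w) x‖ₑ ≤ ∫⁻ t, ‖w (x - t)‖ₑ ∂ρ := by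
      rw [convolution_def]
      refine (enorm_integral_le_lintegral_enorm _).trans (le_of_eq ?_)
      rw [hρ, lintegral_withDensity_eq_lintegral_mul₀ hφm.aemeasurable (hshift x).enorm]
      refine lintegral_congr fun t ↦ ?_
      simp only [ContinuousLinearMap.lsmul_apply, Pi.mul_apply, enorm_smul]
      rw [Real.enorm_of_nonneg (φ.nonneg_normed t)]
    have h2 : ∫⁻ t, ‖w (x - t)‖ₑ ∂ρ ≤ (∫⁻ t, ‖w (x - t)‖ₑ ^ p ∂ρ) ^ (1 / p) := by
      have hac : ρ ≪ μ := withDensity_absolutelyContinuous _ _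
      have := eLpNorm'_le_eLpNorm'_of_exponent_le (p := 1) (q := p) one_pos hp (μ := ρ)
        ((hshift x).mono_ac hac)
      simpa [eLpNorm'] using this
    calc ‖(φ.normed μ ⋆[lsmul ℝ ℝ, μ] w) x‖ₑ ^ p
        ≤ ((∫⁻ t, ‖w (x - t)‖ₑ ^ p ∂ρ) ^ (1 / p)) ^ p :=
          ENNReal.rpow_le_rpow (h1.trans h2) hp0.le
      _ = ∫⁻ t, ‖w (x - t)‖ₑ ^ p ∂ρ := by
          rw [← ENNReal.rpow_mul, one_div, inv_mul_cancel₀ hp0.ne', ENNReal.rpow_one]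
      _ = _ := by
          rw [hρ, lintegral_withDensity_eq_lintegral_mul₀ hφm.aemeasurable
            ((hshift x).enorm.pow_const p)]
          rfl
  calc ∫⁻ x, ‖(φ.normed μ ⋆[lsmul ℝ ℝ, μ] w) x‖ₑ ^ p ∂μ
      ≤ ∫⁻ x, ∫⁻ t, ENNReal.ofReal (φ.normed μ t) * ‖w (x - t)‖ₑ ^ p ∂μ ∂μ :=
        lintegral_mono key
    _ = ∫⁻ t, ∫⁻ x, ENNReal.ofReal (φ.normed μ t) * ‖w (x - t)‖ₑ ^ p ∂μ ∂μ := by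
        refine lintegral_lintegral_swap ?_
        refine AEMeasurable.mul (hφm.comp measurable_snd).aemeasurable ?_
        exact ((hw.comp_quasiMeasurePreserving
          (quasiMeasurePreserving_sub_of_right_invariant μ μ)).enorm).pow_const p
    _ = ∫⁻ t, ENNReal.ofReal (φ.normed μ t) * ∫⁻ x, ‖w x‖ₑ ^ p ∂μ ∂μ := by
        refine lintegral_congr fun t ↦ ?_
        rw [lintegral_const_mul' _ _ ENNReal.ofReal_ne_top,
          lintegral_sub_right_eq_self (fun x ↦ ‖w x‖ₑ ^ p) t]
    _ = ∫⁻ x, ‖w x‖ₑ ^ p ∂μ := by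
        rw [lintegral_mul_const _ hφm, lintegral_ofReal_normed, one_mul]

theorem eLpNorm_normed_convolution_le (φ : ContDiffBump (0 : E)) {w : E → F}
    (hw : AEStronglyMeasurable w μ) {p : ℝ} (hp : 1 ≤ p) :
    eLpNorm (φ.normed μ ⋆[lsmul ℝ ℝ, μ] w) (ENNReal.ofReal p) μ ≤
      eLpNorm w (ENNReal.ofReal p) μ := by
  have hp0 : 0 < p := zero_lt_one.trans_le hp
  rw [eLpNorm_eq_lintegral_rpow_enorm_toReal (by simpa using hp0) ENNReal.ofReal_ne_top,
    eLpNorm_eq_lintegral_rpow_enorm_toReal (by simpa using hp0) ENNReal.ofReal_ne_top,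
    ENNReal.toReal_ofReal hp0.le]
  exact ENNReal.rpow_le_rpow (lintegral_enorm_normed_convolution_rpow_le φ hw hp)
    (by positivity)

theorem normed_convolution_sub (φ : ContDiffBump (0 : E)) {v w : E → F}
    (hv : LocallyIntegrable v μ) (hw : LocallyIntegrable w μ) :
    (φ.normed μ ⋆[lsmul ℝ ℝ, μ] (v - w)) =
      (φ.normed μ ⋆[lsmul ℝ ℝ, μ] v) - (φ.normed μ ⋆[lsmul ℝ ℝ, μ] w) := by
  funext x
  have h (z : E → F) (hz : LocallyIntegrable z μ) :
      ConvolutionExistsAt (φ.normed μ) z x (lsmul ℝ ℝ) μ :=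
    φ.hasCompactSupport_normed.convolutionExists_left _ φ.continuous_normed hz x
  simp only [convolution_def, Pi.sub_apply, map_sub]
  exact integral_sub (h v hv) (h w hw)

variable [CompleteSpace F]

/-- Uniform continuity makes the convergence uniform, and once the radii are at most 1 everything is
supported in one compact set of finite measure. -/
theorem tendsto_eLpNorm_normed_convolution_sub_of_continuous {φ : ℕ → ContDiffBump (0 : E)}
    (hφ : Tendsto (fun n ↦ (φ n).rOut) atTop (𝓝 0)) {v : E → F} (hv : Continuous v)
    (hvs : HasCompactSupport v) {p : ℝ} (hp : 1 ≤ p) :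
    Tendsto (fun n ↦ eLpNorm ((φ n).normed μ ⋆[lsmul ℝ ℝ, μ] v - v) (ENNReal.ofReal p) μ)
      atTop (𝓝 0) := by
  have hp0 : 0 < p := zero_lt_one.trans_le hp
  set S : Set E := Metric.cthickening 1 (tsupport v) with hS
  have hSc : IsCompact S := hvs.isCompact.cthickening
  set c : ℝ≥0∞ := μ S ^ (1 / p)
  have hc : c ≠ ⊤ := ENNReal.rpow_ne_top_of_nonneg (by positivity) hSc.measure_lt_top.ne
  have hsupp : ∀ n, (φ n).rOut ≤ 1 → ∀ x ∉ S,
      ((φ n).normed μ ⋆[lsmul ℝ ℝ, μ] v - v) x = 0 := by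
    intro n hn x hx
    have hx' : ∀ y ∈ Metric.closedBall x 1, v y = 0 := fun y hy ↦ by
      by_contra h
      exact hx (Metric.mem_cthickening_of_dist_le x y 1 _ (subset_tsupport v h)
        (by rwa [dist_comm, ← Metric.mem_closedBall]))
    have := (φ n).dist_normed_convolution_le (μ := μ) (x₀ := x) (ε := 0)
      hv.aestronglyMeasurable (fun y hy ↦ by
        rw [hx' y (Metric.ball_subset_closedBall (Metric.ball_subset_ball hn hy)),
          hx' x (Metric.mem_closedBall_self zero_le_one), dist_self])
    simpa [sub_eq_zero] using dist_le_zero.1 this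
  rw [ENNReal.tendsto_nhds_zero]
  intro ε hε
  obtain ⟨δ, hδ, hδε⟩ : ∃ δ : ℝ, 0 < δ ∧ ENNReal.ofReal δ * c ≤ ε := by
    rcases eq_or_ne ε ⊤ with rfl | hε'
    · exact ⟨1, one_pos, le_top⟩
    -- Dividing by `c + 1` rather than `c` covers the case `c = 0`.
    have hpos : 0 < ε / (c + 1) := ENNReal.div_pos hε.ne' (by simp [hc])
    have hne : ε / (c + 1) ≠ ⊤ := (ENNReal.div_lt_top hε' (by simp)).ne
    refine ⟨(ε / (c + 1)).toReal, ENNReal.toReal_pos hpos.ne' hne, ?_⟩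
    rw [ENNReal.ofReal_toReal hne]
    calc ε / (c + 1) * c ≤ ε / (c + 1) * (c + 1) := by gcongr; exact le_self_add
      _ ≤ ε := (ENNReal.div_mul_cancel (by simp) (by simp [hc])).le
  have huc := hvs.uniformContinuous_of_continuous hv
  obtain ⟨η, hη, hηv⟩ := Metric.uniformContinuous_iff.1 huc δ hδ
  filter_upwards [hφ.eventually_lt_const hη, hφ.eventually_lt_const one_pos] with n hn hn1
  have hbound : ∀ x, ‖((φ n).normed μ ⋆[lsmul ℝ ℝ, μ] v - v) x‖ ≤ δ := fun x ↦ by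
    rw [Pi.sub_apply, ← dist_eq_norm]
    exact (φ n).dist_normed_convolution_le hv.aestronglyMeasurable
      fun y hy ↦ (hηv ((Metric.mem_ball.1 hy).trans hn)).le
  rw [← eLpNorm_restrict_eq_of_support_subset (s := S)
    (Function.support_subset_iff'.2 (hsupp n hn1.le))]
  refine (eLpNorm_le_of_ae_bound (Eventually.of_forall hbound)).trans ?_
  rw [Measure.restrict_apply_univ, ENNReal.toReal_ofReal hp0.le, mul_comm, ← one_div]
  exact hδε

/-- An `ε/3` argument: `C_c` is dense in `L^p`, and mollification is an `L^p` contraction, so the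
approximation error is not enlarged. -/
theorem tendsto_eLpNorm_normed_convolution_sub {φ : ℕ → ContDiffBump (0 : E)}
    (hφ : Tendsto (fun n ↦ (φ n).rOut) atTop (𝓝 0)) {p : ℝ} (hp : 1 ≤ p) {w : E → F}
    (hw : MemLp w (ENNReal.ofReal p) μ) :
    Tendsto (fun n ↦ eLpNorm ((φ n).normed μ ⋆[lsmul ℝ ℝ, μ] w - w) (ENNReal.ofReal p) μ)
      atTop (𝓝 0) := by
  have hp1 : 1 ≤ ENNReal.ofReal p := by simpa using hp
  rw [ENNReal.tendsto_nhds_zero]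
  intro ε hε
  have hε3 : ε / 3 ≠ 0 := (ENNReal.div_pos hε.ne' (by simp)).ne'
  obtain ⟨v, hvs, hvw, hv, hvLp⟩ := hw.exists_hasCompactSupport_eLpNorm_sub_le
    ENNReal.ofReal_ne_top hε3
  have hconv := tendsto_eLpNorm_normed_convolution_sub_of_continuous (μ := μ) hφ hv hvs hp
  filter_upwards [(ENNReal.tendsto_nhds_zero.1 hconv) _ (pos_iff_ne_zero.2 hε3)] with n hn
  have hwl := hw.locallyIntegrable hp1
  have hvl := hvLp.locallyIntegrable hp1
  have hsplit : (φ n).normed μ ⋆[lsmul ℝ ℝ, μ] w - w =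
      ((φ n).normed μ ⋆[lsmul ℝ ℝ, μ] (w - v)) +
        (((φ n).normed μ ⋆[lsmul ℝ ℝ, μ] v - v) - (w - v)) := by
    rw [normed_convolution_sub _ hwl hvl]; abel
  have hm {z : E → F} (hz : LocallyIntegrable z μ) :
      AEStronglyMeasurable ((φ n).normed μ ⋆[lsmul ℝ ℝ, μ] z) μ :=
    ((φ n).hasCompactSupport_normed.continuous_convolution_left _ (φ n).continuous_normed
      hz).aestronglyMeasurable
  rw [hsplit]
  calc _ ≤ ε / 3 + (ε / 3 + ε / 3) := by
        refine (eLpNorm_add_le (hm (hwl.sub hvl))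
          (((hm hvl).sub hv.aestronglyMeasurable).sub
            (hw.1.sub hv.aestronglyMeasurable)) hp1).trans (add_le_add ?_ ?_)
        · exact (eLpNorm_normed_convolution_le _ (hw.1.sub hv.aestronglyMeasurable) hp).trans hvw
        · exact (eLpNorm_sub_le ((hm hvl).sub hv.aestronglyMeasurable)
            (hw.1.sub hv.aestronglyMeasurable) hp1).trans (add_le_add hn hvw)
    _ = ε := by rw [← add_assoc, ENNReal.add_thirds]

/-- Differentiation and mollification commute for weakly differentiable functions. -/
theorem fderiv_normed_convolution_eq {L W : Set E} (hW : IsOpen W) (hLW : L ⊆ W) {u : E → ℝ}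
    {ℓ : E → E →L[ℝ] ℝ}
    {ι : Type*} (b : Module.Basis ι ℝ E)
    (hweak : ∀ ψ : E → ℝ, ContDiff ℝ ∞ ψ → HasCompactSupport ψ → tsupport ψ ⊆ W → ∀ i,
      ∫ y in W, u y * fderiv ℝ ψ y (b i) ∂μ = -∫ y in W, ℓ y (b i) * ψ y ∂μ)
    (hvl : LocallyIntegrable (L.indicator u) μ) (hℓ'l : LocallyIntegrable (W.indicator ℓ) μ)
    (φ : ContDiffBump (0 : E)) {x : E} (hball : Metric.closedBall x φ.rOut ⊆ L) :
    fderiv ℝ (φ.normed μ ⋆[lsmul ℝ ℝ, μ] L.indicator u) x =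
      (φ.normed μ ⋆[lsmul ℝ ℝ, μ] W.indicator ℓ) x := by
  set v : E → ℝ := L.indicator u with hv
  set ℓ' : E → E →L[ℝ] ℝ := W.indicator ℓ with hℓ'
  have hc : ContDiff ℝ ∞ (φ.normed μ) := φ.contDiff_normed
  have hc1 : ContDiff ℝ 1 (φ.normed μ) := hc.of_le (by exact_mod_cast le_top)
  have h1 := ((φ.hasCompactSupport_normed (μ := μ)).hasFDerivAt_convolution_left (μ := μ)
    (lsmul ℝ ℝ) hc1 hvl x).fderiv
  rw [h1]
  refine ContinuousLinearMap.coe_injective (b.ext fun i ↦ ?_)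
  set z : E := b i with hz
  rw [ContinuousLinearMap.coe_coe, ContinuousLinearMap.coe_coe]
  -- The reflected and translated bump is an admissible test function, its support lying in the ball
  -- inside `L`; differentiating it in `y` instead of `x` produces the sign of the weak derivative.
  set ψ : E → ℝ := fun y ↦ φ.normed μ (x - y) with hψ
  have hψs : tsupport ψ ⊆ Metric.closedBall x φ.rOut := by
    refine closure_minimal (fun y hy ↦ ?_) Metric.isClosed_closedBall
    have : x - y ∈ Function.support (φ.normed μ) := hy
    rw [φ.support_normed_eq, Metric.mem_ball, dist_zero_right] at this
    rw [Metric.mem_closedBall, dist_comm, dist_eq_norm]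
    exact this.le
  have hψc : HasCompactSupport ψ :=
    HasCompactSupport.of_support_subset_isCompact (isCompact_closedBall x φ.rOut)
      (subset_closure.trans hψs)
  have hψd : ContDiff ℝ ∞ ψ := hc.comp (contDiff_const.sub contDiff_id)
  have hψf : ∀ y, fderiv ℝ ψ y z = -fderiv ℝ (φ.normed μ) (x - y) z := by
    intro y
    have hd : HasFDerivAt (φ.normed μ) (fderiv ℝ (φ.normed μ) (x - y)) (x - y) :=
      (hc1.differentiable one_ne_zero _).hasFDerivAt
    have := hd.comp y ((hasFDerivAt_id y).const_sub x)
    rw [show ψ = φ.normed μ ∘ fun y ↦ x - y from rfl, this.fderiv]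
    simp
  have hfs : HasCompactSupport (fderiv ℝ (φ.normed μ)) :=
    (φ.hasCompactSupport_normed (μ := μ)).fderiv (𝕜 := ℝ)
  have hfc : Continuous (fderiv ℝ (φ.normed μ)) := hc1.continuous_fderiv one_ne_zero
  have he1 : ConvolutionExistsAt (fderiv ℝ (φ.normed μ)) v x
      (ContinuousLinearMap.precompL E (lsmul ℝ ℝ)) μ :=
    hfs.convolutionExists_left _ hfc hvl x
  have he2 : ConvolutionExistsAt (φ.normed μ) ℓ' x (lsmul ℝ ℝ) μ :=
    (φ.hasCompactSupport_normed (μ := μ)).convolutionExists_left _ φ.continuous_normed hℓ'l x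
  have hi1 := he1.integrable_swap
  have hi2 := he2.integrable_swap
  rw [convolution_eq_swap, convolution_eq_swap, ContinuousLinearMap.integral_apply hi1,
    ContinuousLinearMap.integral_apply hi2]
  have hw := hweak ψ hψd hψc (hψs.trans (hball.trans hLW)) i
  rw [← hz] at hw
  rw [← integral_indicator hW.measurableSet, ← integral_indicator hW.measurableSet] at hw
  have e1 : ∫ y, (ContinuousLinearMap.precompL E (lsmul ℝ ℝ))
      (fderiv ℝ (φ.normed μ) (x - y)) (v y) z ∂μ =
      -∫ y, W.indicator (fun y ↦ u y * fderiv ℝ ψ y z) y ∂μ := by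
    rw [← integral_neg]
    refine integral_congr_ae (Eventually.of_forall fun y ↦ ?_)
    -- The convolution sees `u` only on `L`, the weak identity on all of `W`; the difference is
    -- invisible because `ψ` is supported in `L`.
    have hzero : y ∉ L → fderiv ℝ ψ y z = 0 := fun hy ↦ by
      have : y ∉ tsupport ψ := fun h ↦ hy (hball (hψs h))
      rw [show fderiv ℝ ψ y = 0 from by
        by_contra h
        exact this (support_fderiv_subset ℝ h)]
      rfl
    by_cases hy : y ∈ L
    · simp [hv, indicator_of_mem hy, indicator_of_mem (hLW hy), hψf,
        ContinuousLinearMap.precompL_apply, mul_comm]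
    · have h0 := hzero hy
      by_cases hyW : y ∈ W <;>
      simp [hv, indicator_of_notMem hy, hyW, h0]
  have e2 : ∫ y, (lsmul ℝ ℝ) (φ.normed μ (x - y)) (ℓ' y) z ∂μ =
      ∫ y, W.indicator (fun y ↦ ℓ y z * ψ y) y ∂μ := by
    refine integral_congr_ae (Eventually.of_forall fun y ↦ ?_)
    by_cases hyW : y ∈ W <;> simp [hℓ', hyW, hψ, mul_comm]
  rw [e1, e2, hw, neg_neg]

/-- A continuous function with a weak differential `ℓ ∈ L^p` is approximated by smooth functions,
together with its differential, on compact subsets. -/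
theorem exists_contDiff_tendsto_of_weak_fderiv {W K : Set E} (hW : IsOpen W) (hK : IsCompact K)
    (hKW : K ⊆ W) {p : ℝ} (hp : 1 ≤ p) {u : E → ℝ} (hu : ContinuousOn u W)
    {ℓ : E → E →L[ℝ] ℝ} (hℓ : MemLp ℓ (ENNReal.ofReal p) (μ.restrict W))
    {ι : Type*} (b : Module.Basis ι ℝ E)
    (hweak : ∀ ψ : E → ℝ, ContDiff ℝ ∞ ψ → HasCompactSupport ψ → tsupport ψ ⊆ W → ∀ i,
      ∫ y in W, u y * fderiv ℝ ψ y (b i) ∂μ = -∫ y in W, ℓ y (b i) * ψ y ∂μ) :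
    ∃ U : ℕ → E → ℝ, (∀ n, ContDiff ℝ ∞ (U n)) ∧
      (∀ x ∈ K, Tendsto (fun n ↦ U n x) atTop (𝓝 (u x))) ∧
      Tendsto (fun n ↦ eLpNorm (fderiv ℝ (U n) - ℓ) (ENNReal.ofReal p) (μ.restrict K))
        atTop (𝓝 0) := by
  have hp1 : 1 ≤ ENNReal.ofReal p := by simpa using hp
  -- Continuity of `u` on `W` does not make it integrable there. Truncating to a compact `L`
  -- containing a neighbourhood of `K` does, and leaves the mollified functions on `K` unaffected
  -- for small radii.
  obtain ⟨L, hL, hKL, hLW⟩ := exists_compact_between hK hW hKW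
  obtain ⟨δ, hδ, hδL⟩ := hK.exists_thickening_subset_open isOpen_interior hKL
  set v : E → ℝ := L.indicator u with hv
  have hvi : Integrable v μ :=
    ((hu.mono hLW).integrableOn_compact hL).integrable_indicator hL.measurableSet
  have hvl : LocallyIntegrable v μ := hvi.locallyIntegrable
  set ℓ' : E → E →L[ℝ] ℝ := W.indicator ℓ with hℓ'
  have hℓ'p : MemLp ℓ' (ENNReal.ofReal p) μ :=
    memLp_indicator_of_restrict hW.measurableSet hℓ
  have hℓ'l : LocallyIntegrable ℓ' μ := hℓ'p.locallyIntegrable hp1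
  obtain ⟨φ, hφ⟩ : ∃ φ : ℕ → ContDiffBump (0 : E), Tendsto (fun n ↦ (φ n).rOut) atTop (𝓝 0) :=
    ⟨fun n ↦ ⟨1 / ((n : ℝ) + 1) / 2, 1 / ((n : ℝ) + 1), by positivity,
      half_lt_self (by positivity)⟩, tendsto_one_div_add_atTop_nhds_zero_nat⟩
  set U : ℕ → E → ℝ := fun n ↦ (φ n).normed μ ⋆[lsmul ℝ ℝ, μ] v with hU
  have hUs : ∀ n, ContDiff ℝ ∞ (U n) := fun n ↦ by
    have hc : HasCompactSupport ((φ n).normed μ) := (φ n).hasCompactSupport_normed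
    have hd : ContDiff ℝ ∞ ((φ n).normed μ) := (φ n).contDiff_normed
    exact hc.contDiff_convolution_left _ hd hvl
  refine ⟨U, hUs, fun x hx ↦ ?_, ?_⟩
  · have hvx : ContinuousAt v x := by
      have hLx : L ∈ 𝓝 x := mem_interior_iff_mem_nhds.1 (hKL hx)
      refine (hu.continuousAt (hW.mem_nhds (hKW hx))).congr ?_
      filter_upwards [hLx] with y hy using (indicator_of_mem hy u).symm
    have hvx' : v x = u x := indicator_of_mem (interior_subset (hKL hx)) u
    rw [← hvx']
    exact ContDiffBump.convolution_tendsto_right hφ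
      (Eventually.of_forall fun _ ↦ hvi.aestronglyMeasurable) (hvx.tendsto.comp tendsto_snd)
      tendsto_const_nhds
  · have hderiv : ∀ n, (φ n).rOut < δ → ∀ x ∈ K,
        fderiv ℝ (U n) x = ((φ n).normed μ ⋆[lsmul ℝ ℝ, μ] ℓ') x := fun n hn x hx ↦
      fderiv_normed_convolution_eq hW hLW b hweak hvl hℓ'l _ fun y hy ↦ interior_subset
        (hδL (Metric.mem_thickening_iff.2 ⟨x, hx, (Metric.mem_closedBall.1 hy).trans_lt hn⟩))
    refine tendsto_of_tendsto_of_tendsto_of_le_of_le' tendsto_const_nhds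
      (tendsto_eLpNorm_normed_convolution_sub hφ hp hℓ'p) (Eventually.of_forall fun _ ↦ zero_le)
      ?_
    filter_upwards [hφ.eventually_lt_const hδ] with n hn
    refine le_trans (le_of_eq ?_) (eLpNorm_mono_measure _ (Measure.restrict_le_self (s := K)))
    refine eLpNorm_congr_ae ?_
    filter_upwards [ae_restrict_mem hK.measurableSet] with x hx
    rw [Pi.sub_apply, Pi.sub_apply, hderiv n hn x hx, hℓ', indicator_of_mem (hKW hx)]

end Mollification

/-! ### Coordinate fields and the Gram matrix of a chart. -/

section Charts

variable {m : ℕ} {M : Type*} [TopologicalSpace M] [ChartedSpace (EuclideanSpace ℝ (Fin m)) M]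

theorem mdifferentiable_of_mem_maximalAtlas
    {e : OpenPartialHomeomorph M (EuclideanSpace ℝ (Fin m))}
    (he : e ∈ IsManifold.maximalAtlas (𝓡 m) ∞ M) : e.MDifferentiable (𝓡 m) (𝓡 m) :=
  ⟨(contMDiffOn_of_mem_maximalAtlas he).mdifferentiableOn (by simp),
    (contMDiffOn_symm_of_mem_maximalAtlas he).mdifferentiableOn (by simp)⟩

variable [RiemannianBundle (fun x : M ↦ TangentSpace (𝓡 m) x)]

theorem isContinuousRiemannianBundle_tangent [IsManifold (𝓡 m) ∞ M]
    [h : IsContMDiffRiemannianBundle (𝓡 m) ∞ (EuclideanSpace ℝ (Fin m))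
      (fun x : M ↦ TangentSpace (𝓡 m) x)] :
    IsContinuousRiemannianBundle (EuclideanSpace ℝ (Fin m))
      (fun x : M ↦ TangentSpace (𝓡 m) x) := by
  obtain ⟨g, hg, hgi⟩ := h.exists_contMDiff
  exact ⟨g, hg.continuous, hgi⟩

omit [RiemannianBundle (fun x : M ↦ TangentSpace (𝓡 m) x)] in
theorem linearIndependent_coordField {e : OpenPartialHomeomorph M (EuclideanSpace ℝ (Fin m))}
    (he : e ∈ IsManifold.maximalAtlas (𝓡 m) ∞ M) {y : EuclideanSpace ℝ (Fin m)}
    (hy : y ∈ e.target) : LinearIndependent ℝ (coordField e y) := by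
  have h := (mdifferentiable_of_mem_maximalAtlas he).symm.ker_mfderiv_eq_bot hy
  have hb := (EuclideanSpace.basisFun (Fin m) ℝ).toBasis.linearIndependent
  have := hb.map' (mfderiv (𝓡 m) (𝓡 m) e.symm y).toLinearMap h
  have heq : coordField e y = (mfderiv (𝓡 m) (𝓡 m) e.symm y).toLinearMap ∘
      (EuclideanSpace.basisFun (Fin m) ℝ).toBasis := by
    funext i
    have hi : EuclideanSpace.single i (1 : ℝ) = (EuclideanSpace.basisFun (Fin m) ℝ).toBasis i := by
      simp
    exact congrArg (mfderiv (𝓡 m) (𝓡 m) e.symm y) hi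
  rw [heq]
  exact this

theorem det_gramMatrix_pos {e : OpenPartialHomeomorph M (EuclideanSpace ℝ (Fin m))}
    (he : e ∈ IsManifold.maximalAtlas (𝓡 m) ∞ M) {y : EuclideanSpace ℝ (Fin m)}
    (hy : y ∈ e.target) : 0 < (gramMatrix e y).det :=
  (Matrix.posDef_gram_of_linearIndependent (linearIndependent_coordField he hy)).det_pos

omit [RiemannianBundle (fun x : M ↦ TangentSpace (𝓡 m) x)] in
theorem continuousOn_coordField [IsManifold (𝓡 m) ∞ M]
    {e : OpenPartialHomeomorph M (EuclideanSpace ℝ (Fin m))}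
    (he : e ∈ IsManifold.maximalAtlas (𝓡 m) ∞ M) (i : Fin m) :
    ContinuousOn (fun y ↦ (⟨e.symm y, coordField e y i⟩ : TangentBundle (𝓡 m) M)) e.target := by
  have h := (contMDiffOn_symm_of_mem_maximalAtlas he).continuousOn_tangentMapWithin (by simp)
    e.open_target.uniqueMDiffOn
  have hc : Continuous (fun y : EuclideanSpace ℝ (Fin m) ↦
      (⟨y, EuclideanSpace.single i (1 : ℝ)⟩ :
        TangentBundle (𝓡 m) (EuclideanSpace ℝ (Fin m)))) := by
    rw [(tangentBundleModelSpaceHomeomorph (𝓡 m)).isInducing.continuous_iff]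
    exact continuous_id.prodMk continuous_const
  refine (h.comp hc.continuousOn fun y hy ↦ hy).congr fun y hy ↦ ?_
  simp only [Function.comp_apply, tangentMapWithin, coordField]
  rw [mfderivWithin_of_isOpen e.open_target hy]

theorem continuousOn_gramMatrix [IsManifold (𝓡 m) ∞ M]
    [IsContinuousRiemannianBundle (EuclideanSpace ℝ (Fin m)) (fun x : M ↦ TangentSpace (𝓡 m) x)]
    {e : OpenPartialHomeomorph M (EuclideanSpace ℝ (Fin m))}
    (he : e ∈ IsManifold.maximalAtlas (𝓡 m) ∞ M) : ContinuousOn (gramMatrix e) e.target := by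
  refine continuousOn_pi.2 fun i ↦ continuousOn_pi.2 fun j ↦ ?_
  exact ContinuousOn.inner_bundle (continuousOn_coordField he i) (continuousOn_coordField he j)

end Charts

/-! ### Transformation of the metric under a change of chart. -/

section Transition

variable {m : ℕ} {M : Type*} [TopologicalSpace M] [ChartedSpace (EuclideanSpace ℝ (Fin m)) M]

theorem differentiableAt_transition
    {e e' : OpenPartialHomeomorph M (EuclideanSpace ℝ (Fin m))}
    (he : e ∈ IsManifold.maximalAtlas (𝓡 m) ∞ M) (he' : e' ∈ IsManifold.maximalAtlas (𝓡 m) ∞ M)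
    {y : EuclideanSpace ℝ (Fin m)} (hy : y ∈ e'.target) (hy' : e'.symm y ∈ e.source) :
    DifferentiableAt ℝ (e ∘ e'.symm) y := by
  rw [← mdifferentiableAt_iff_differentiableAt]
  exact ((mdifferentiable_of_mem_maximalAtlas he).mdifferentiableAt hy').comp y
    ((mdifferentiable_of_mem_maximalAtlas he').mdifferentiableAt_symm hy)

variable [RiemannianBundle (fun x : M ↦ TangentSpace (𝓡 m) x)]

/-- The metric at a point, on the model space of the tangent space. -/
def metricForm (x : M) :
    EuclideanSpace ℝ (Fin m) →ₗ[ℝ] EuclideanSpace ℝ (Fin m) →ₗ[ℝ] ℝ :=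
  (innerₗ (TangentSpace (𝓡 m) x) :
    TangentSpace (𝓡 m) x →ₗ[ℝ] TangentSpace (𝓡 m) x →ₗ[ℝ] ℝ)

theorem gramMatrix_eq_metricForm (e : OpenPartialHomeomorph M (EuclideanSpace ℝ (Fin m)))
    (y : EuclideanSpace ℝ (Fin m)) (i j : Fin m) :
    gramMatrix e y i j = metricForm (e.symm y) (coordField e y i) (coordField e y j) := rfl

/-- Near `y` the inverse chart `e'.symm` factors as `e.symm` after the transition map. By the chain
rule the columns of `J` expand the coordinate fields of `e'` in those of `e`, and bilinearity does
the rest. -/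
theorem gramMatrix_transition {e e' : OpenPartialHomeomorph M (EuclideanSpace ℝ (Fin m))}
    (he : e ∈ IsManifold.maximalAtlas (𝓡 m) ∞ M) (he' : e' ∈ IsManifold.maximalAtlas (𝓡 m) ∞ M)
    {y : EuclideanSpace ℝ (Fin m)} (hy : y ∈ e'.target) (hy' : e'.symm y ∈ e.source) :
    let J := LinearMap.toMatrix (EuclideanSpace.basisFun (Fin m) ℝ).toBasis
      (EuclideanSpace.basisFun (Fin m) ℝ).toBasis (fderiv ℝ (e ∘ e'.symm) y).toLinearMap
    gramMatrix e' y = J.transpose * gramMatrix e ((e ∘ e'.symm) y) * J := by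
  intro J
  have hd := differentiableAt_transition he he' hy hy'
  set T := e ∘ e'.symm with hT
  have hTy : T y ∈ e.target := e.map_source hy'
  have heq : e'.symm =ᶠ[𝓝 y] e.symm ∘ T := by
    have : e'.symm ⁻¹' e.source ∈ 𝓝 y :=
      (e'.continuousAt_symm hy).preimage_mem_nhds (e.open_source.mem_nhds hy')
    filter_upwards [this] with z hz
    exact (e.left_inv hz).symm
  set A : EuclideanSpace ℝ (Fin m) →L[ℝ] EuclideanSpace ℝ (Fin m) :=
    mfderiv (𝓡 m) (𝓡 m) e.symm (T y) with hA
  have hchain : (mfderiv (𝓡 m) (𝓡 m) e'.symm y :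
      EuclideanSpace ℝ (Fin m) →L[ℝ] EuclideanSpace ℝ (Fin m)) = A.comp (fderiv ℝ T y) := by
    have h := mfderiv_comp y
      ((mdifferentiable_of_mem_maximalAtlas he).mdifferentiableAt_symm hTy)
      hd.mdifferentiableAt
    rw [mfderiv_eq_fderiv] at h
    exact heq.mfderiv_eq.trans h
  have hcoord : ∀ i, (coordField e' y i : EuclideanSpace ℝ (Fin m)) =
      ∑ k, J k i • A (EuclideanSpace.single k 1) := by
    intro i
    have h1 : fderiv ℝ T y (EuclideanSpace.single i 1) =
        ∑ k, J k i • EuclideanSpace.single k (1 : ℝ) := by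
      have := (EuclideanSpace.basisFun (Fin m) ℝ).toBasis.sum_repr
        (fderiv ℝ T y (EuclideanSpace.single i 1))
      rw [← this]
      refine Finset.sum_congr rfl fun k _ ↦ ?_
      simp [J, LinearMap.toMatrix_apply, hT]
    have h2 : (coordField e' y i : EuclideanSpace ℝ (Fin m)) =
        A (fderiv ℝ T y (EuclideanSpace.single i 1)) :=
      congrArg (fun A : EuclideanSpace ℝ (Fin m) →L[ℝ] EuclideanSpace ℝ (Fin m) ↦
        A (EuclideanSpace.single i 1)) hchain
    rw [h2, h1, map_sum]
    exact Finset.sum_congr rfl fun k _ ↦ map_smul _ _ _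
  have hgram : ∀ k l, gramMatrix e (T y) k l = metricForm (e.symm (T y))
    (A (EuclideanSpace.single k 1)) (A (EuclideanSpace.single l 1)) := fun k l ↦ rfl
  ext i j
  rw [gramMatrix_eq_metricForm, hcoord i, hcoord j, heq.self_of_nhds]
  simp only [map_sum, map_smul, LinearMap.sum_apply, LinearMap.smul_apply, smul_eq_mul,
    Matrix.mul_apply, Matrix.transpose_apply, Finset.sum_mul, Finset.mul_sum, hgram,
    Function.comp_apply]
  refine Finset.sum_congr rfl fun k _ ↦ Finset.sum_congr rfl fun l _ ↦ ?_
  ring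

/-- The congruence by `J` contributes `(det J)²`, whose root is exactly the Jacobian factor in the
change of variables formula; hence the density is independent of the chart. -/
theorem sqrt_det_gramMatrix_transition
    {e e' : OpenPartialHomeomorph M (EuclideanSpace ℝ (Fin m))}
    (he : e ∈ IsManifold.maximalAtlas (𝓡 m) ∞ M) (he' : e' ∈ IsManifold.maximalAtlas (𝓡 m) ∞ M)
    {y : EuclideanSpace ℝ (Fin m)} (hy : y ∈ e'.target) (hy' : e'.symm y ∈ e.source) :
    √(gramMatrix e' y).det =
      |(fderiv ℝ (e ∘ e'.symm) y).det| * √(gramMatrix e ((e ∘ e'.symm) y)).det := by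
  rw [gramMatrix_transition he he' hy hy', Matrix.det_mul, Matrix.det_mul, Matrix.det_transpose,
    LinearMap.det_toMatrix]
  set d := LinearMap.det (fderiv ℝ (e ∘ e'.symm) y).toLinearMap with hd
  rw [show d * (gramMatrix e ((e ∘ e'.symm) y)).det * d =
    d ^ 2 * (gramMatrix e ((e ∘ e'.symm) y)).det by ring, Real.sqrt_mul (sq_nonneg d),
    Real.sqrt_sq_eq_abs]

end Transition

/-! ### The Riemannian volume on the domain of a chart, compared with Lebesgue measure. -/

section Volume

variable {m : ℕ} {M : Type*} [TopologicalSpace M] [ChartedSpace (EuclideanSpace ℝ (Fin m)) M]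
  [MeasurableSpace M] [BorelSpace M]

theorem measurableSet_source_inter_preimage {X Y : Type*} [TopologicalSpace X]
    [MeasurableSpace X] [BorelSpace X] [TopologicalSpace Y] [MeasurableSpace Y] [BorelSpace Y]
    (e : OpenPartialHomeomorph X Y) {s : Set Y} (hs : MeasurableSet s) :
    MeasurableSet (e.source ∩ e ⁻¹' s) := by
  have h : Measurable (fun y : e.source ↦ e y) :=
    (continuousOn_iff_continuous_domRestrict.1 e.continuousOn).measurable
  have := e.open_source.measurableSet.subtype_image (h hs)
  rwa [show (fun y : e.source ↦ e y) ⁻¹' s = Subtype.val ⁻¹' (e ⁻¹' s) from rfl,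
    Subtype.image_preimage_coe] at this

omit [ChartedSpace (EuclideanSpace ℝ (Fin m)) M] in
theorem measurableSet_target_inter_preimage
    (e : OpenPartialHomeomorph M (EuclideanSpace ℝ (Fin m))) {s : Set M} (hs : MeasurableSet s) :
    MeasurableSet (e.target ∩ e.symm ⁻¹' s) :=
  measurableSet_source_inter_preimage e.symm hs

omit [ChartedSpace (EuclideanSpace ℝ (Fin m)) M] in
theorem aemeasurable_symm (e : OpenPartialHomeomorph M (EuclideanSpace ℝ (Fin m)))
    {μ : Measure (EuclideanSpace ℝ (Fin m))} (hμ : μ ≪ volume.restrict e.target) :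
    AEMeasurable e.symm μ :=
  (e.continuousOn_symm.aemeasurable e.open_target.measurableSet).mono_ac hμ

variable [RiemannianBundle (fun x : M ↦ TangentSpace (𝓡 m) x)]

theorem chartVolume_apply (e : OpenPartialHomeomorph M (EuclideanSpace ℝ (Fin m))) {s : Set M}
    (hs : MeasurableSet s) :
    chartVolume e s =
      ∫⁻ y in e.target ∩ e.symm ⁻¹' s, ENNReal.ofReal √(gramMatrix e y).det := by
  have hm := measurableSet_target_inter_preimage e hs
  rw [chartVolume, Measure.map_apply_of_aemeasurable
    (aemeasurable_symm e (withDensity_absolutelyContinuous _ _)) hs,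
    ← restrict_withDensity e.open_target.measurableSet,
    Measure.restrict_apply' e.open_target.measurableSet, inter_comm, withDensity_apply _ hm]

/-- Change of variables along the transition map. An inequality is enough, so the image of the
overlap need only be contained in the coordinate image of `s`. -/
theorem chartVolume_restrict_source_le {e e' : OpenPartialHomeomorph M (EuclideanSpace ℝ (Fin m))}
    (he : e ∈ IsManifold.maximalAtlas (𝓡 m) ∞ M) (he' : e' ∈ IsManifold.maximalAtlas (𝓡 m) ∞ M) :
    (chartVolume e').restrict e.source ≤ chartVolume e := by
  refine Measure.le_iff.2 fun s hs ↦ ?_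
  have hse : MeasurableSet (s ∩ e.source) := hs.inter e.open_source.measurableSet
  rw [Measure.restrict_apply hs, chartVolume_apply e' hse, chartVolume_apply e hs]
  set A := e'.target ∩ e'.symm ⁻¹' (s ∩ e.source) with hA
  set T := e ∘ e'.symm with hT
  have hAm : MeasurableSet A := measurableSet_target_inter_preimage e' hse
  have hinj : InjOn T A := fun y hy z hz hyz ↦
    e'.symm.injOn hy.1 hz.1 (e.injOn hy.2.2 hz.2.2 hyz)
  have hder : ∀ y ∈ A, HasFDerivWithinAt T (fderiv ℝ T y) A y := fun y hy ↦
    (differentiableAt_transition he he' hy.1 hy.2.2).hasFDerivAt.hasFDerivWithinAt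
  have hsub : T '' A ⊆ e.target ∩ e.symm ⁻¹' s := by
    rintro _ ⟨y, hy, rfl⟩
    refine ⟨e.map_source hy.2.2, ?_⟩
    rw [mem_preimage, hT, Function.comp_apply, e.left_inv hy.2.2]
    exact hy.2.1
  calc ∫⁻ y in A, ENNReal.ofReal √(gramMatrix e' y).det
      = ∫⁻ y in A, ENNReal.ofReal |(fderiv ℝ T y).det| *
          ENNReal.ofReal √(gramMatrix e (T y)).det := by
        refine setLIntegral_congr_fun hAm fun y hy ↦ ?_
        rw [sqrt_det_gramMatrix_transition he he' hy.1 hy.2.2, ENNReal.ofReal_mul (abs_nonneg _)]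
    _ = ∫⁻ z in T '' A, ENNReal.ofReal √(gramMatrix e z).det :=
        (lintegral_image_eq_lintegral_abs_det_fderiv_mul volume hAm hder hinj
          fun z ↦ ENNReal.ofReal √(gramMatrix e z).det).symm
    _ ≤ _ := lintegral_mono_set hsub

omit [BorelSpace M] in
theorem chartVolume_le_riemannianVolume
    {e : OpenPartialHomeomorph M (EuclideanSpace ℝ (Fin m))}
    (he : e ∈ IsManifold.maximalAtlas (𝓡 m) ∞ M) : chartVolume e ≤ riemannianVolume m M :=
  le_iSup₂_of_le e he le_rfl

/-- Minimality of the supremum: `chartVolume e` plus the Riemannian volume off `e.source` already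
dominates every chart volume, hence dominates the Riemannian volume. Restricting to `e.source` kills
the second summand. -/
theorem riemannianVolume_restrict_source_le
    {e : OpenPartialHomeomorph M (EuclideanSpace ℝ (Fin m))}
    (he : e ∈ IsManifold.maximalAtlas (𝓡 m) ∞ M) :
    (riemannianVolume m M).restrict e.source ≤ chartVolume e := by
  have hs := e.open_source.measurableSet
  have h : riemannianVolume m M ≤
      chartVolume e + (riemannianVolume m M).restrict e.sourceᶜ := by
    refine iSup₂_le fun e' he' ↦ ?_
    rw [← Measure.restrict_add_restrict_compl (μ := chartVolume e') hs]
    exact add_le_add (chartVolume_restrict_source_le he he')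
      (Measure.restrict_mono le_rfl (chartVolume_le_riemannianVolume he'))
  calc (riemannianVolume m M).restrict e.source
      ≤ (chartVolume e + (riemannianVolume m M).restrict e.sourceᶜ).restrict e.source :=
        Measure.restrict_mono le_rfl h
    _ = (chartVolume e).restrict e.source := by
        rw [Measure.restrict_add, Measure.restrict_restrict hs, inter_compl_self,
          Measure.restrict_empty, add_zero]
    _ ≤ chartVolume e := Measure.restrict_le_self

/-- Lebesgue measure on the part of a chart which corresponds to `A`, transported to the
manifold. -/
def coordMeasure (e : OpenPartialHomeomorph M (EuclideanSpace ℝ (Fin m))) (A : Set M) :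
    Measure M :=
  Measure.map e.symm (volume.restrict (e.target ∩ e.symm ⁻¹' A))

omit [RiemannianBundle (fun x : M ↦ TangentSpace (𝓡 m) x)]
  [ChartedSpace (EuclideanSpace ℝ (Fin m)) M] in
theorem coordMeasure_apply (e : OpenPartialHomeomorph M (EuclideanSpace ℝ (Fin m)))
    {A s : Set M} (hA : MeasurableSet A) (hs : MeasurableSet s) :
    coordMeasure e A s = volume (e.target ∩ e.symm ⁻¹' (s ∩ A)) := by
  rw [coordMeasure, Measure.map_apply_of_aemeasurable (aemeasurable_symm e
    (Measure.restrict_mono_set _ inter_subset_left).absolutelyContinuous) hs,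
    Measure.restrict_apply' (measurableSet_target_inter_preimage e hA)]
  congr 1
  ext y
  simp only [mem_inter_iff, mem_preimage]
  tauto

/-- An upper bound on the density carries estimates from coordinates to the manifold; the lower
bound in `coordMeasure_le_riemannianVolume_restrict` carries them back. -/
theorem map_riemannianVolume_restrict_le
    {e : OpenPartialHomeomorph M (EuclideanSpace ℝ (Fin m))}
    (he : e ∈ IsManifold.maximalAtlas (𝓡 m) ∞ M) {A : Set M} (hA : MeasurableSet A)
    (hAe : A ⊆ e.source) {C : ℝ}
    (hC : ∀ x ∈ A, √(gramMatrix e (e x)).det ≤ C) :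
    ((riemannianVolume m M).restrict A).map e ≤
      ENNReal.ofReal C • volume.restrict (e.target ∩ e.symm ⁻¹' A) := by
  have hem : AEMeasurable e ((riemannianVolume m M).restrict A) :=
    (e.continuousOn.mono hAe).aemeasurable hA
  refine Measure.le_iff.2 fun s hs ↦ ?_
  have hsA : MeasurableSet (A ∩ e ⁻¹' s) := by
    rw [← inter_eq_left.2 hAe, inter_assoc]
    exact hA.inter (measurableSet_source_inter_preimage e hs)
  have hW : e.target ∩ e.symm ⁻¹' (A ∩ e ⁻¹' s) = s ∩ (e.target ∩ e.symm ⁻¹' A) := by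
    ext y
    simp only [mem_inter_iff, mem_preimage]
    constructor
    · rintro ⟨h1, h2, h3⟩
      rw [e.right_inv h1] at h3
      exact ⟨h3, h1, h2⟩
    · rintro ⟨h3, h1, h2⟩
      rw [e.right_inv h1]
      exact ⟨h1, h2, h3⟩
  rw [Measure.map_apply_of_aemeasurable hem hs, Measure.restrict_apply' hA, inter_comm,
    Measure.smul_apply, Measure.restrict_apply hs, smul_eq_mul, ← hW]
  calc riemannianVolume m M (A ∩ e ⁻¹' s)
      = (riemannianVolume m M).restrict e.source (A ∩ e ⁻¹' s) := by
        rw [Measure.restrict_apply hsA, inter_eq_left.2 (inter_subset_left.trans hAe)]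
    _ ≤ chartVolume e (A ∩ e ⁻¹' s) := riemannianVolume_restrict_source_le he _
    _ = ∫⁻ y in e.target ∩ e.symm ⁻¹' (A ∩ e ⁻¹' s), ENNReal.ofReal √(gramMatrix e y).det :=
        chartVolume_apply e hsA
    _ ≤ ∫⁻ y in e.target ∩ e.symm ⁻¹' (A ∩ e ⁻¹' s), ENNReal.ofReal C := by
        refine setLIntegral_mono' (measurableSet_target_inter_preimage e hsA) fun y hy ↦ ?_
        have := hC _ hy.2.1
        rw [e.right_inv hy.1] at this
        exact ENNReal.ofReal_le_ofReal this
    _ = _ := by rw [lintegral_const, Measure.restrict_apply_univ]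

theorem coordMeasure_le_riemannianVolume_restrict
    {e : OpenPartialHomeomorph M (EuclideanSpace ℝ (Fin m))}
    (he : e ∈ IsManifold.maximalAtlas (𝓡 m) ∞ M) {A : Set M} (hA : MeasurableSet A)
    {c : ℝ} (hc0 : 0 < c) (hc : ∀ x ∈ A, c ≤ √(gramMatrix e (e x)).det) :
    coordMeasure e A ≤ ENNReal.ofReal c⁻¹ • (riemannianVolume m M).restrict A := by
  refine Measure.le_iff.2 fun s hs ↦ ?_
  have hsA := hs.inter hA
  rw [Measure.smul_apply, Measure.restrict_apply hs, coordMeasure_apply e hA hs, smul_eq_mul,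
    ENNReal.ofReal_inv_of_pos hc0, mul_comm, ← div_eq_mul_inv,
    ENNReal.le_div_iff_mul_le (by simp [hc0]) (by simp), mul_comm]
  calc ENNReal.ofReal c * volume (e.target ∩ e.symm ⁻¹' (s ∩ A))
      = ∫⁻ y in e.target ∩ e.symm ⁻¹' (s ∩ A), ENNReal.ofReal c := by
        rw [lintegral_const, Measure.restrict_apply_univ]
    _ ≤ ∫⁻ y in e.target ∩ e.symm ⁻¹' (s ∩ A), ENNReal.ofReal √(gramMatrix e y).det := by
        refine setLIntegral_mono' (measurableSet_target_inter_preimage e hsA) fun y hy ↦ ?_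
        have := hc _ hy.2.2
        rw [e.right_inv hy.1] at this
        exact ENNReal.ofReal_le_ofReal this
    _ = chartVolume e (s ∩ A) := (chartVolume_apply e hsA).symm
    _ ≤ riemannianVolume m M (s ∩ A) := chartVolume_le_riemannianVolume he _

end Volume

/-! ### Hölder pairing of forms with vector fields, and passage to the limit. -/

section Convergence

variable {α : Type*} {_ : MeasurableSpace α} {ν : Measure α}
  {E : Type*} [NormedAddCommGroup E] [NormedSpace ℝ E] {p q : ℝ}

theorem aestronglyMeasurable_clm_apply {D : α → E →L[ℝ] ℝ} {Y : α → E}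
    (hD : AEStronglyMeasurable D ν) (hY : AEStronglyMeasurable Y ν) :
    AEStronglyMeasurable (fun x ↦ D x (Y x)) ν :=
  (isBoundedBilinearMap_apply (𝕜 := ℝ) (E := E) (F := ℝ)).continuous.comp_aestronglyMeasurable
    (hD.prodMk hY)

theorem eLpNorm_one_clm_apply_le (hpq : p.HolderConjugate q) {D : α → E →L[ℝ] ℝ} {Y : α → E}
    (hD : AEStronglyMeasurable D ν) (hY : AEStronglyMeasurable Y ν) :
    eLpNorm (fun x ↦ D x (Y x)) 1 ν ≤
      eLpNorm D (ENNReal.ofReal p) ν * eLpNorm Y (ENNReal.ofReal q) ν := by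
  have := hpq.ennrealOfReal
  have h := eLpNorm_le_eLpNorm_mul_eLpNorm_of_nnnorm (p := ENNReal.ofReal p) (q := ENNReal.ofReal q)
    (r := 1) hD hY (fun A v ↦ A v) 1
    (Eventually.of_forall fun x ↦ by simpa using (D x).le_opNNNorm (Y x))
  simpa using h

theorem integrable_clm_apply (hpq : p.HolderConjugate q) {D : α → E →L[ℝ] ℝ} {Y : α → E}
    (hD : MemLp D (ENNReal.ofReal p) ν) (hY : MemLp Y (ENNReal.ofReal q) ν) :
    Integrable (fun x ↦ D x (Y x)) ν :=
  memLp_one_iff_integrable.1 ⟨aestronglyMeasurable_clm_apply hD.1 hY.1,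
    (eLpNorm_one_clm_apply_le hpq hD.1 hY.1).trans_lt (ENNReal.mul_lt_top hD.2 hY.2)⟩

theorem integrable_mul_clm_apply (hpq : p.HolderConjugate q) {a : α → ℝ} {D : α → E →L[ℝ] ℝ}
    {Y : α → E} {B : ℝ} (ha : AEStronglyMeasurable a ν) (hB : ∀ᵐ x ∂ν, ‖a x‖ ≤ B)
    (hD : MemLp D (ENNReal.ofReal p) ν) (hY : MemLp Y (ENNReal.ofReal q) ν) :
    Integrable (fun x ↦ a x * D x (Y x)) ν :=
  (integrable_clm_apply hpq hD hY).bdd_mul ha hB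

/-- Split `aₙ Dₙ = aₙ (Dₙ - L) + aₙ L`. The first part vanishes by Hölder and the uniform bound on
`aₙ`; the second converges by dominated convergence, so bounded pointwise convergence of `aₙ`
suffices. -/
theorem tendsto_integral_mul_clm_apply (hpq : p.HolderConjugate q) {a : ℕ → α → ℝ} {b : α → ℝ}
    {D : ℕ → α → E →L[ℝ] ℝ} {L : α → E →L[ℝ] ℝ} {Y : α → E} {B : ℝ}
    (ha : ∀ n, AEStronglyMeasurable (a n) ν) (hB : ∀ n, ∀ᵐ x ∂ν, ‖a n x‖ ≤ B)
    (hab : ∀ᵐ x ∂ν, Tendsto (fun n ↦ a n x) atTop (𝓝 (b x)))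
    (hD : ∀ n, AEStronglyMeasurable (D n) ν)
    (hDL : Tendsto (fun n ↦ eLpNorm (D n - L) (ENNReal.ofReal p) ν) atTop (𝓝 0))
    (hL : MemLp L (ENNReal.ofReal p) ν) (hY : MemLp Y (ENNReal.ofReal q) ν) :
    Tendsto (fun n ↦ ∫ x, a n x * D n x (Y x) ∂ν) atTop (𝓝 (∫ x, b x * L x (Y x) ∂ν)) := by
  have hb : AEStronglyMeasurable b ν := aestronglyMeasurable_of_tendsto_ae atTop ha hab
  have hLY : Integrable (fun x ↦ L x (Y x)) ν := integrable_clm_apply hpq hL hY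
  have h1 : Tendsto (fun n ↦ ∫ x, a n x * L x (Y x) ∂ν) atTop (𝓝 (∫ x, b x * L x (Y x) ∂ν)) := by
    refine tendsto_integral_of_dominated_convergence (fun x ↦ B * ‖L x (Y x)‖)
      (fun n ↦ (ha n).mul hLY.1) (hLY.norm.const_mul B) (fun n ↦ ?_) ?_
    · filter_upwards [hB n] with x hx
      rw [norm_mul]
      gcongr
    · filter_upwards [hab] with x hx using hx.mul_const _
  -- The individual `D n` are not assumed to be in `L^p`; only for large `n` does convergence force
  -- the difference to be.
  have hDL' : ∀ᶠ n in atTop, MemLp (D n - L) (ENNReal.ofReal p) ν := by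
    filter_upwards [hDL.eventually_lt_const (u := 1) one_pos] with n hn
    exact ⟨(hD n).sub hL.1, hn.trans ENNReal.one_lt_top⟩
  have h2 : Tendsto (fun n ↦ ∫ x, a n x * (D n - L) x (Y x) ∂ν) atTop (𝓝 0) := by
    have h0 : ∫ _x : α, (0 : ℝ) ∂ν = 0 := by simp
    rw [← h0]
    refine tendsto_integral_of_L1' _ aestronglyMeasurable_const
      (hDL'.mono fun n hn ↦ integrable_mul_clm_apply hpq (ha n) (hB n) hn hY) ?_
    have hlim : Tendsto (fun n ↦ ENNReal.ofReal B * (eLpNorm (D n - L) (ENNReal.ofReal p) ν *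
        eLpNorm Y (ENNReal.ofReal q) ν)) atTop (𝓝 0) := by
      have h3 := ENNReal.Tendsto.mul_const (b := eLpNorm Y (ENNReal.ofReal q) ν) hDL
        (Or.inr hY.2.ne)
      rw [zero_mul] at h3
      have h4 := ENNReal.Tendsto.const_mul (a := ENNReal.ofReal B) h3
        (Or.inr ENNReal.ofReal_ne_top)
      rwa [mul_zero] at h4
    refine tendsto_of_tendsto_of_tendsto_of_le_of_le tendsto_const_nhds hlim
      (fun _ ↦ zero_le) fun n ↦ ?_
    refine le_trans (eLpNorm_le_mul_eLpNorm_of_ae_le_mul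
      (g := fun x ↦ (D n - L) x (Y x)) (c := B) ?_ 1) ?_
    · filter_upwards [hB n] with x hx
      simp only [Pi.sub_apply, sub_zero, norm_mul]
      gcongr
    · gcongr
      exact eLpNorm_one_clm_apply_le hpq ((hD n).sub hL.1) hY.1
  have h3 := h2.add h1
  rw [zero_add] at h3
  refine h3.congr' ?_
  filter_upwards [hDL'] with n hn
  rw [← integral_add (integrable_mul_clm_apply hpq (ha n) (hB n) hn hY)
    (integrable_mul_clm_apply hpq (ha n) (hB n) hL hY)]
  refine integral_congr_ae (Eventually.of_forall fun x ↦ ?_)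
  simp only [Pi.sub_apply, sub_apply]
  ring

end Convergence

/-! ### Neighbourhoods on which the metric is comparable to the Euclidean one. -/

section ChartNeighborhood

variable {m : ℕ} {M : Type*} [TopologicalSpace M] [ChartedSpace (EuclideanSpace ℝ (Fin m)) M]
  [RiemannianBundle (fun x : M ↦ TangentSpace (𝓡 m) x)]

/-- On the open subset `U` of the domain of the chart `e`, the Riemannian metric is comparable to
the Euclidean metric of the chart, with constant `C`. -/
structure IsChartNeighborhood (e : OpenPartialHomeomorph M (EuclideanSpace ℝ (Fin m)))
    (U : Set M) (C : ℝ) : Prop where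
  mem_maximalAtlas : e ∈ IsManifold.maximalAtlas (𝓡 m) ∞ M
  isOpen : IsOpen U
  subset_source : U ⊆ e.source
  pos : 0 < C
  norm_coordExpr_le : ∀ x ∈ U, ∀ X : (∀ x : M, TangentSpace (𝓡 m) x),
    ‖coordExpr e X x‖ ≤ C * ‖X x‖
  norm_mfderiv_symm_le : ∀ y ∈ e.target, e.symm y ∈ U → ∀ v : EuclideanSpace ℝ (Fin m),
    ‖(mfderiv (𝓡 m) (𝓡 m) e.symm y v : TangentSpace (𝓡 m) (e.symm y))‖ ≤ C * ‖v‖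
  le_det : ∀ x ∈ U, C⁻¹ ≤ √(gramMatrix e (e x)).det
  det_le : ∀ x ∈ U, √(gramMatrix e (e x)).det ≤ C

theorem IsChartNeighborhood.mono {e : OpenPartialHomeomorph M (EuclideanSpace ℝ (Fin m))}
    {U V : Set M} {C : ℝ} (h : IsChartNeighborhood e U C) (hV : IsOpen V) (hVU : V ⊆ U) :
    IsChartNeighborhood e V C where
  mem_maximalAtlas := h.mem_maximalAtlas
  isOpen := hV
  subset_source := hVU.trans h.subset_source
  pos := h.pos
  norm_coordExpr_le x hx := h.norm_coordExpr_le x (hVU hx)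
  norm_mfderiv_symm_le y hy hyV := h.norm_mfderiv_symm_le y hy (hVU hyV)
  le_det x hx := h.le_det x (hVU hx)
  det_le x hx := h.det_le x (hVU hx)

/-- A continuous metric keeps the derivatives of the chart and of its inverse bounded near `x₀`, and
keeps the positive volume density near its value `d` at `x₀`. -/
theorem exists_isChartNeighborhood [IsManifold (𝓡 m) ∞ M]
    [IsContinuousRiemannianBundle (EuclideanSpace ℝ (Fin m)) (fun x : M ↦ TangentSpace (𝓡 m) x)]
    (x₀ : M) : ∃ (e : OpenPartialHomeomorph M (EuclideanSpace ℝ (Fin m))) (U : Set M) (C : ℝ),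
      x₀ ∈ U ∧ IsChartNeighborhood e U C := by
  set e := chartAt (EuclideanSpace ℝ (Fin m)) x₀ with he
  have heA : e ∈ IsManifold.maximalAtlas (𝓡 m) ∞ M := IsManifold.chart_mem_maximalAtlas x₀
  have hx₀ : x₀ ∈ e.source := mem_chart_source _ x₀
  have hdet : ContinuousOn (fun x ↦ √(gramMatrix e (e x)).det) e.source :=
    (((continuous_id.matrix_det).comp_continuousOn (continuousOn_gramMatrix heA)).comp
      e.continuousOn e.mapsTo).sqrt
  set d := √(gramMatrix e (e x₀)).det with hd
  have hd0 : 0 < d := Real.sqrt_pos.2 (det_gramMatrix_pos heA (e.map_source hx₀))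
  have hdetx := hdet.continuousAt (e.open_source.mem_nhds hx₀)
  obtain ⟨C₁, hC₁, h₁⟩ := eventually_norm_mfderiv_extChartAt_lt (𝓡 m) x₀
  obtain ⟨C₂, hC₂, h₂⟩ := eventually_norm_mfderivWithin_symm_extChartAt_comp_lt (𝓡 m) x₀
  have h₃ := hdetx.eventually_const_lt (u := d / 2) (half_lt_self hd0)
  have h₄ := hdetx.eventually_lt_const (u := 2 * d) (by linarith)
  have hall := ((h₁.and h₂).and (h₃.and h₄)).and (e.open_source.mem_nhds hx₀)
  obtain ⟨U, hU, hUo, hxU⟩ := eventually_nhds_iff.1 hall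
  -- One constant for all four bounds: the density lies between `d / 2` and `2 * d`, and `(d / 2)⁻¹`
  -- enters because the lower bound is required as `C⁻¹`.
  set C := max (max C₁ C₂) (max (2 * d) (d / 2)⁻¹) with hC
  have hCpos : 0 < C := hC₁.trans_le ((le_max_left _ _).trans (le_max_left _ _))
  refine ⟨e, U, C, hxU, heA, hUo, fun x hx ↦ (hU x hx).2, hCpos, fun x hx X ↦ ?_,
    fun y hy hyU v ↦ ?_, fun x hx ↦ ?_, fun x hx ↦ ?_⟩
  · have h := (hU x hx).1.1.1.le
    exact ContinuousLinearMap.le_of_opNorm_le (E := TangentSpace (𝓡 m) x)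
      (F := EuclideanSpace ℝ (Fin m)) _
      (h.trans ((le_max_left _ _).trans (le_max_left _ _))) (X x)
  · have h := (hU _ hyU).1.1.2.le
    have hy' : extChartAt (𝓡 m) x₀ (e.symm y) = y := e.right_inv hy
    rw [hy'] at h
    simp only [modelWithCornersSelf_coe, range_id, mfderivWithin_univ] at h
    exact ContinuousLinearMap.le_of_opNorm_le (E := EuclideanSpace ℝ (Fin m))
      (F := TangentSpace (𝓡 m) (e.symm y)) _
      (h.trans ((le_max_right _ _).trans (le_max_left _ _))) v
  · refine le_trans (inv_anti₀ (inv_pos.2 (half_pos hd0))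
      ((le_max_right _ _).trans (le_max_right _ _))) ?_
    rw [inv_inv]
    exact (hU x hx).1.2.1.le
  · exact (hU x hx).1.2.2.le.trans ((le_max_left _ _).trans (le_max_right _ _))

end ChartNeighborhood

/-! ### The form `⟨G, ·⟩` in coordinates. -/

section PullbackForm

variable {m : ℕ} {M : Type*} [TopologicalSpace M] [ChartedSpace (EuclideanSpace ℝ (Fin m)) M]
  [RiemannianBundle (fun x : M ↦ TangentSpace (𝓡 m) x)]

/-- The coordinate expression of the differential form `⟨G, ·⟩` in a chart. -/
def pullbackForm (e : OpenPartialHomeomorph M (EuclideanSpace ℝ (Fin m)))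
    (G : ∀ x : M, TangentSpace (𝓡 m) x) (y : EuclideanSpace ℝ (Fin m)) :
    EuclideanSpace ℝ (Fin m) →L[ℝ] ℝ :=
  LinearMap.toContinuousLinearMap ((metricForm (e.symm y) (G (e.symm y))).comp
    (mfderiv (𝓡 m) (𝓡 m) e.symm y :
      EuclideanSpace ℝ (Fin m) →L[ℝ] EuclideanSpace ℝ (Fin m)).toLinearMap)

theorem pullbackForm_apply (e : OpenPartialHomeomorph M (EuclideanSpace ℝ (Fin m)))
    (G : ∀ x : M, TangentSpace (𝓡 m) x) (y v : EuclideanSpace ℝ (Fin m)) :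
    pullbackForm e G y v = inner ℝ (G (e.symm y)) (mfderiv (𝓡 m) (𝓡 m) e.symm y v) := rfl

theorem pullbackForm_single (e : OpenPartialHomeomorph M (EuclideanSpace ℝ (Fin m)))
    (G : ∀ x : M, TangentSpace (𝓡 m) x) (y : EuclideanSpace ℝ (Fin m)) (i : Fin m) :
    pullbackForm e G y (EuclideanSpace.single i 1) =
      inner ℝ (G (e.symm y)) (coordField e y i) := rfl

omit [RiemannianBundle (fun x : M ↦ TangentSpace (𝓡 m) x)] in
theorem mfderiv_symm_coordExpr {e : OpenPartialHomeomorph M (EuclideanSpace ℝ (Fin m))}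
    (he : e ∈ IsManifold.maximalAtlas (𝓡 m) ∞ M) (X : ∀ x : M, TangentSpace (𝓡 m) x) {x : M}
    (hx : x ∈ e.source) :
    (mfderiv (𝓡 m) (𝓡 m) e.symm (e x) (coordExpr e X x) : EuclideanSpace ℝ (Fin m)) = X x := by
  have h := (mdifferentiable_of_mem_maximalAtlas he).symm_comp_deriv hx
  exact congrArg (fun A : TangentSpace (𝓡 m) x →L[ℝ] TangentSpace (𝓡 m) x ↦ A (X x)) h

theorem pullbackForm_coordExpr {e : OpenPartialHomeomorph M (EuclideanSpace ℝ (Fin m))}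
    (he : e ∈ IsManifold.maximalAtlas (𝓡 m) ∞ M) (G X : ∀ x : M, TangentSpace (𝓡 m) x) {x : M}
    (hx : x ∈ e.source) :
    pullbackForm e G (e x) (coordExpr e X x) = inner ℝ (G x) (X x) := by
  have h1 : pullbackForm e G (e x) (coordExpr e X x) =
      metricForm (e.symm (e x)) (G (e.symm (e x))) (X x) :=
    congrArg (metricForm (e.symm (e x)) (G (e.symm (e x)))) (mfderiv_symm_coordExpr he X hx)
  -- The base point `e.symm (e x)` is replaced by `x` at the level of forms on the fixed model
  -- space, where the type does not depend on the point.
  have h2 := congrArg (fun z ↦ metricForm z (G z)) (e.left_inv hx)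
  rw [h1]
  exact congrArg (fun A : EuclideanSpace ℝ (Fin m) →ₗ[ℝ] ℝ ↦ A (X x)) h2

/-- Lowering the index. It is needed for measurability, which is known for the components of `G` in
charts and not directly for those of the form. -/
theorem pullbackForm_single_eq_sum {e : OpenPartialHomeomorph M (EuclideanSpace ℝ (Fin m))}
    (he : e ∈ IsManifold.maximalAtlas (𝓡 m) ∞ M) (G : ∀ x : M, TangentSpace (𝓡 m) x)
    {y : EuclideanSpace ℝ (Fin m)} (hy : y ∈ e.target) (i : Fin m) :
    pullbackForm e G y (EuclideanSpace.single i 1) =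
      ∑ j, coordExpr e G (e.symm y) j * gramMatrix e y j i := by
  have h := mfderiv_symm_coordExpr he G (e.map_target hy)
  rw [e.right_inv hy] at h
  set A : EuclideanSpace ℝ (Fin m) →L[ℝ] EuclideanSpace ℝ (Fin m) :=
    mfderiv (𝓡 m) (𝓡 m) e.symm y with hA
  have hsum : coordExpr e G (e.symm y) =
      ∑ j, coordExpr e G (e.symm y) j • EuclideanSpace.single j (1 : ℝ) := by
    have := (EuclideanSpace.basisFun (Fin m) ℝ).sum_repr (coordExpr e G (e.symm y))
    simpa using this.symm
  have h2 : (G (e.symm y) : EuclideanSpace ℝ (Fin m)) =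
      ∑ j, coordExpr e G (e.symm y) j • A (EuclideanSpace.single j 1) := by
    rw [← h]
    change A _ = _
    conv_lhs => rw [hsum]
    rw [map_sum]
    exact Finset.sum_congr rfl fun j _ ↦ map_smul _ _ _
  have h3 : pullbackForm e G y (EuclideanSpace.single i 1) =
      metricForm (e.symm y) (G (e.symm y)) (A (EuclideanSpace.single i 1)) := rfl
  rw [h3, h2]
  simp only [map_sum, map_smul, LinearMap.sum_apply, LinearMap.smul_apply, smul_eq_mul]
  rfl

theorem norm_pullbackForm_le {e : OpenPartialHomeomorph M (EuclideanSpace ℝ (Fin m))}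
    {U : Set M} {C : ℝ} (h : IsChartNeighborhood e U C) (G : ∀ x : M, TangentSpace (𝓡 m) x)
    {y : EuclideanSpace ℝ (Fin m)} (hy : y ∈ e.target) (hyU : e.symm y ∈ U) :
    ‖pullbackForm e G y‖ ≤ C * ‖G (e.symm y)‖ := by
  refine ContinuousLinearMap.opNorm_le_bound _ (mul_nonneg h.pos.le (norm_nonneg _)) fun v ↦ ?_
  rw [pullbackForm_apply]
  refine (norm_inner_le_norm _ _).trans ?_
  rw [mul_comm C, mul_assoc]
  gcongr
  exact h.norm_mfderiv_symm_le y hy hyU v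

end PullbackForm

/-! ### Transfer of measurability and integrability between the manifold and coordinates. -/

namespace IsChartNeighborhood

variable {m : ℕ} {M : Type*} [TopologicalSpace M] [ChartedSpace (EuclideanSpace ℝ (Fin m)) M]
  [RiemannianBundle (fun x : M ↦ TangentSpace (𝓡 m) x)] [MeasurableSpace M] [BorelSpace M]
  {e : OpenPartialHomeomorph M (EuclideanSpace ℝ (Fin m))} {U : Set M} {C : ℝ}

theorem coordMeasure_le (h : IsChartNeighborhood e U C) :
    coordMeasure e U ≤ ENNReal.ofReal C⁻¹⁻¹ • (riemannianVolume m M).restrict U :=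
  coordMeasure_le_riemannianVolume_restrict h.mem_maximalAtlas h.isOpen.measurableSet
    (inv_pos.2 h.pos) h.le_det

theorem map_le (h : IsChartNeighborhood e U C) {A : Set M} (hA : MeasurableSet A) (hAU : A ⊆ U) :
    ((riemannianVolume m M).restrict A).map e ≤
      ENNReal.ofReal C • volume.restrict (e.target ∩ e.symm ⁻¹' A) :=
  map_riemannianVolume_restrict_le h.mem_maximalAtlas hA (hAU.trans h.subset_source)
    fun x hx ↦ h.det_le x (hAU hx)

theorem aemeasurable_chart (h : IsChartNeighborhood e U C) {A : Set M} (hA : MeasurableSet A)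
    (hAU : A ⊆ U) : AEMeasurable e ((riemannianVolume m M).restrict A) :=
  (e.continuousOn.mono (hAU.trans h.subset_source)).aemeasurable hA

omit [ChartedSpace (EuclideanSpace ℝ (Fin m)) M]
  [RiemannianBundle (fun x : M ↦ TangentSpace (𝓡 m) x)] in
theorem _root_.KarpStokes.aemeasurable_symm_restrict
    (e : OpenPartialHomeomorph M (EuclideanSpace ℝ (Fin m))) (A : Set M) :
    AEMeasurable e.symm (volume.restrict (e.target ∩ e.symm ⁻¹' A)) :=
  aemeasurable_symm e (Measure.restrict_mono_set _ inter_subset_left).absolutelyContinuous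

theorem aestronglyMeasurable_comp_symm (h : IsChartNeighborhood e U C) {F : Type*}
    [TopologicalSpace F] {w : M → F}
    (hw : AEStronglyMeasurable w ((riemannianVolume m M).restrict U)) :
    AEStronglyMeasurable (fun y ↦ w (e.symm y)) (volume.restrict (e.target ∩ e.symm ⁻¹' U)) :=
  (hw.mono_ac (Measure.absolutelyContinuous_of_le_smul h.coordMeasure_le)).comp_aemeasurable
    (aemeasurable_symm_restrict e U)

theorem integrableOn_comp_symm (h : IsChartNeighborhood e U C) {w : M → ℝ}
    (hw : IntegrableOn w U (riemannianVolume m M)) :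
    IntegrableOn (fun y ↦ w (e.symm y)) (e.target ∩ e.symm ⁻¹' U) :=
  (Integrable.of_measure_le_smul ENNReal.ofReal_ne_top h.coordMeasure_le hw).comp_aemeasurable
    (aemeasurable_symm_restrict e U)

theorem eLpNorm_comp_chart_le (h : IsChartNeighborhood e U C) {A : Set M}
    (hA : MeasurableSet A) (hAU : A ⊆ U) {F : Type*} [NormedAddCommGroup F]
    {v : EuclideanSpace ℝ (Fin m) → F}
    (hv : AEStronglyMeasurable v (volume.restrict (e.target ∩ e.symm ⁻¹' A))) {p : ℝ≥0∞}
    (hp : p ≠ ⊤) :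
    eLpNorm (fun x ↦ v (e x)) p ((riemannianVolume m M).restrict A) ≤
      ENNReal.ofReal C ^ (1 / p).toReal •
        eLpNorm v p (volume.restrict (e.target ∩ e.symm ⁻¹' A)) := by
  rw [← eLpNorm_smul_measure_of_ne_top hp]
  refine le_trans (le_of_eq ?_) (eLpNorm_mono_measure v (h.map_le hA hAU))
  exact (eLpNorm_map_measure
    (hv.mono_ac (Measure.absolutelyContinuous_of_le_smul (h.map_le hA hAU)))
    (h.aemeasurable_chart hA hAU)).symm

theorem memLp_comp_chart (h : IsChartNeighborhood e U C) {A : Set M}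
    (hA : MeasurableSet A) (hAU : A ⊆ U) {F : Type*} [NormedAddCommGroup F]
    {v : EuclideanSpace ℝ (Fin m) → F} {p : ℝ≥0∞}
    (hv : MemLp v p (volume.restrict (e.target ∩ e.symm ⁻¹' A))) :
    MemLp (fun x ↦ v (e x)) p ((riemannianVolume m M).restrict A) :=
  (hv.of_measure_le_smul ENNReal.ofReal_ne_top (h.map_le hA hAU)).comp_of_map
    (h.aemeasurable_chart hA hAU)

theorem measure_lt_top (h : IsChartNeighborhood e U C) {K : Set M} (hK : IsCompact K)
    (hKm : MeasurableSet K) (hKU : K ⊆ U) : riemannianVolume m M K < ⊤ := by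
  have hKe : e.target ∩ e.symm ⁻¹' K = e '' K :=
    (e.image_eq_target_inter_inv_preimage (hKU.trans h.subset_source)).symm
  have h1 := h.map_le hKm hKU univ
  rw [Measure.map_apply_of_aemeasurable (h.aemeasurable_chart hKm hKU) MeasurableSet.univ,
    preimage_univ, Measure.restrict_apply_univ, Measure.smul_apply, Measure.restrict_apply_univ,
    hKe] at h1
  refine h1.trans_lt (ENNReal.mul_lt_top ENNReal.ofReal_lt_top ?_)
  exact (hK.image_of_continuousOn
    (e.continuousOn.mono (hKU.trans h.subset_source))).measure_lt_top

theorem memLp_coordExpr (h : IsChartNeighborhood e U C) {q : ℝ} (hq : 0 < q)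
    {X : ∀ x : M, TangentSpace (𝓡 m) x} (hX : MemLpLoc q X)
    (hXU : IntegrableOn (fun x ↦ ‖X x‖ ^ q) U (riemannianVolume m M)) :
    MemLp (coordExpr e X) (ENNReal.ofReal q) ((riemannianVolume m M).restrict U) := by
  have hm : AEStronglyMeasurable (coordExpr e X) ((riemannianVolume m M).restrict U) :=
    (hX.aestronglyMeasurable e h.mem_maximalAtlas).mono_measure
      (Measure.restrict_mono_set _ h.subset_source)
  rw [← integrable_norm_rpow_iff hm (by simpa using hq) ENNReal.ofReal_ne_top,
    ENNReal.toReal_ofReal hq.le]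
  refine (hXU.const_mul (C ^ q)).mono' (hm.norm.aemeasurable.pow_const q).aestronglyMeasurable ?_
  filter_upwards [ae_restrict_mem h.isOpen.measurableSet] with x hx
  rw [Real.norm_of_nonneg (by positivity), ← Real.mul_rpow h.pos.le (norm_nonneg _)]
  exact Real.rpow_le_rpow (norm_nonneg _) (h.norm_coordExpr_le x hx X) hq.le

theorem aestronglyMeasurable_pullbackForm [IsManifold (𝓡 m) ∞ M]
    [IsContinuousRiemannianBundle (EuclideanSpace ℝ (Fin m)) (fun x : M ↦ TangentSpace (𝓡 m) x)]
    (h : IsChartNeighborhood e U C) {p : ℝ} {G : ∀ x : M, TangentSpace (𝓡 m) x}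
    (hG : MemLpLoc p G) :
    AEStronglyMeasurable (pullbackForm e G) (volume.restrict (e.target ∩ e.symm ⁻¹' U)) := by
  have hWm := measurableSet_target_inter_preimage e h.isOpen.measurableSet
  have hm : AEStronglyMeasurable (fun y ↦ coordExpr e G (e.symm y))
      (volume.restrict (e.target ∩ e.symm ⁻¹' U)) :=
    h.aestronglyMeasurable_comp_symm ((hG.aestronglyMeasurable e h.mem_maximalAtlas).mono_measure
      (Measure.restrict_mono_set _ h.subset_source))
  have hi : ∀ i, AEStronglyMeasurable
      (fun y ↦ pullbackForm e G y (EuclideanSpace.single i 1))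
      (volume.restrict (e.target ∩ e.symm ⁻¹' U)) := by
    intro i
    have hs : AEStronglyMeasurable
        (fun y ↦ ∑ j, coordExpr e G (e.symm y) j * gramMatrix e y j i)
        (volume.restrict (e.target ∩ e.symm ⁻¹' U)) := by
      refine Finset.aestronglyMeasurable_fun_sum _ fun j _ ↦ AEStronglyMeasurable.mul ?_ ?_
      · exact (EuclideanSpace.proj j :
          EuclideanSpace ℝ (Fin m) →L[ℝ] ℝ).continuous.comp_aestronglyMeasurable hm
      · have hc : ContinuousOn (fun y ↦ gramMatrix e y j i) e.target :=
          continuousOn_pi.1 (continuousOn_pi.1 (continuousOn_gramMatrix h.mem_maximalAtlas) j) i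
        exact (hc.mono inter_subset_left).aestronglyMeasurable hWm
    refine hs.congr ?_
    filter_upwards [ae_restrict_mem hWm] with y hy
    exact (pullbackForm_single_eq_sum h.mem_maximalAtlas G hy.1 i).symm
  have hsum : pullbackForm e G = fun y ↦ ∑ i, pullbackForm e G y (EuclideanSpace.single i 1) •
      (EuclideanSpace.proj i : EuclideanSpace ℝ (Fin m) →L[ℝ] ℝ) := by
    funext y
    ext v
    have := (EuclideanSpace.basisFun (Fin m) ℝ).sum_repr v
    conv_lhs => rw [← this]
    simp [mul_comm]
  rw [hsum]
  exact Finset.aestronglyMeasurable_fun_sum _ fun i _ ↦ (hi i).smul_const _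

theorem memLp_pullbackForm [IsManifold (𝓡 m) ∞ M]
    [IsContinuousRiemannianBundle (EuclideanSpace ℝ (Fin m)) (fun x : M ↦ TangentSpace (𝓡 m) x)]
    (h : IsChartNeighborhood e U C) {p : ℝ} (hp : 0 < p) {G : ∀ x : M, TangentSpace (𝓡 m) x}
    (hG : MemLpLoc p G)
    (hGU : IntegrableOn (fun x ↦ ‖G x‖ ^ p) U (riemannianVolume m M)) :
    MemLp (pullbackForm e G) (ENNReal.ofReal p)
      (volume.restrict (e.target ∩ e.symm ⁻¹' U)) := by
  have hWm := measurableSet_target_inter_preimage e h.isOpen.measurableSet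
  have hm := h.aestronglyMeasurable_pullbackForm hG
  rw [← integrable_norm_rpow_iff hm (by simpa using hp) ENNReal.ofReal_ne_top,
    ENNReal.toReal_ofReal hp.le]
  refine ((h.integrableOn_comp_symm hGU).const_mul (C ^ p)).mono'
    (hm.norm.aemeasurable.pow_const p).aestronglyMeasurable ?_
  filter_upwards [ae_restrict_mem hWm] with y hy
  rw [Real.norm_of_nonneg (by positivity), ← Real.mul_rpow h.pos.le (norm_nonneg _)]
  exact Real.rpow_le_rpow (norm_nonneg _) (norm_pullbackForm_le h G hy.1 hy.2) hp.le

end IsChartNeighborhood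

/-! ### Directional derivatives and the weak gradient in a single chart. -/

section Localization

variable {m : ℕ} {M : Type*} [TopologicalSpace M] [ChartedSpace (EuclideanSpace ℝ (Fin m)) M]

/-- The derivative of the function `φ` in the direction of the vector field `X`. -/
def dirDeriv (φ : M → ℝ) (X : ∀ x : M, TangentSpace (𝓡 m) x) (x : M) : ℝ :=
  mfderiv (𝓡 m) 𝓘(ℝ, ℝ) φ x (X x)

theorem dirDeriv_eq_fderiv_coordExpr
    {e : OpenPartialHomeomorph M (EuclideanSpace ℝ (Fin m))}
    (he : e ∈ IsManifold.maximalAtlas (𝓡 m) ∞ M) {g : M → ℝ} {x : M} (hx : x ∈ e.source)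
    (hg : MDifferentiableAt (𝓡 m) 𝓘(ℝ, ℝ) g x) (X : ∀ x : M, TangentSpace (𝓡 m) x) :
    dirDeriv g X x =
      fderiv ℝ (g ∘ e.symm) (e x) (coordExpr e X x) := by
  have hed := (mdifferentiable_of_mem_maximalAtlas he)
  have hes : MDifferentiableAt (𝓡 m) (𝓡 m) e.symm (e x) :=
    hed.mdifferentiableAt_symm (e.map_source hx)
  have hg' : MDifferentiableAt (𝓡 m) 𝓘(ℝ, ℝ) g (e.symm (e x)) := by rwa [e.left_inv hx]
  have heq : g =ᶠ[𝓝 x] (g ∘ e.symm) ∘ e := by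
    filter_upwards [e.open_source.mem_nhds hx] with z hz
    simp [e.left_inv hz]
  have h1 := mfderiv_comp x (hg'.comp (e x) hes) (hed.mdifferentiableAt hx)
  rw [mfderiv_eq_fderiv] at h1
  have h2 : (mfderiv (𝓡 m) 𝓘(ℝ, ℝ) g x : EuclideanSpace ℝ (Fin m) →L[ℝ] ℝ) =
      (fderiv ℝ (g ∘ e.symm) (e x)).comp (mfderiv (𝓡 m) (𝓡 m) e x) :=
    heq.mfderiv_eq.trans h1
  exact congrArg (fun A : EuclideanSpace ℝ (Fin m) →L[ℝ] ℝ ↦ A (X x)) h2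

theorem dirDeriv_eq_zero_of_notMem_tsupport {g : M → ℝ} {x : M} (hx : x ∉ tsupport g)
    (X : ∀ x : M, TangentSpace (𝓡 m) x) : dirDeriv g X x = 0 := by
  have h : g =ᶠ[𝓝 x] fun _ ↦ 0 := notMem_tsupport_iff_eventuallyEq.1 hx
  have h2 : (mfderiv (𝓡 m) 𝓘(ℝ, ℝ) g x : EuclideanSpace ℝ (Fin m) →L[ℝ] ℝ) = 0 :=
    h.mfderiv_eq.trans mfderiv_const
  exact congrArg (fun A : EuclideanSpace ℝ (Fin m) →L[ℝ] ℝ ↦ A (X x)) h2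

theorem contDiffOn_comp_symm {e : OpenPartialHomeomorph M (EuclideanSpace ℝ (Fin m))}
    (he : e ∈ IsManifold.maximalAtlas (𝓡 m) ∞ M) {χ : M → ℝ}
    (hχ : ContMDiff (𝓡 m) 𝓘(ℝ, ℝ) ∞ χ) : ContDiffOn ℝ ∞ (χ ∘ e.symm) e.target :=
  (hχ.comp_contMDiffOn (contMDiffOn_symm_of_mem_maximalAtlas he)).contDiffOn

/-- Outside the chart domain `g ∘ e` carries no information, but smoothness need only be checked on
the support of `χ`, which lies inside. -/
theorem contMDiff_mul_comp_chart {e : OpenPartialHomeomorph M (EuclideanSpace ℝ (Fin m))}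
    (he : e ∈ IsManifold.maximalAtlas (𝓡 m) ∞ M) {χ : M → ℝ}
    (hχ : ContMDiff (𝓡 m) 𝓘(ℝ, ℝ) ∞ χ) (hχe : tsupport χ ⊆ e.source)
    {g : EuclideanSpace ℝ (Fin m) → ℝ} (hg : ContDiff ℝ ∞ g) :
    ContMDiff (𝓡 m) 𝓘(ℝ, ℝ) ∞ (fun x ↦ χ x * g (e x)) := by
  refine contMDiff_of_tsupport fun x hx ↦ ?_
  have hxe : x ∈ e.source := hχe (tsupport_mul_subset_left hx)
  have he' : ContMDiffAt (𝓡 m) (𝓡 m) ∞ e x :=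
    (contMDiffOn_of_mem_maximalAtlas he).contMDiffAt (e.open_source.mem_nhds hxe)
  exact hχ.contMDiffAt.mul (hg.contMDiff.contMDiffAt.comp x he')

theorem dirDeriv_mul_comp_chart {e : OpenPartialHomeomorph M (EuclideanSpace ℝ (Fin m))}
    (he : e ∈ IsManifold.maximalAtlas (𝓡 m) ∞ M) {χ : M → ℝ}
    (hχ : ContMDiff (𝓡 m) 𝓘(ℝ, ℝ) ∞ χ) (hχe : tsupport χ ⊆ e.source)
    {g : EuclideanSpace ℝ (Fin m) → ℝ} (hg : ContDiff ℝ ∞ g) {Λ : ℝ → ℝ} (hΛ : ContDiff ℝ ∞ Λ)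
    (X : ∀ x : M, TangentSpace (𝓡 m) x) {x : M} (hx : x ∈ e.source) :
    dirDeriv (fun x ↦ χ x * Λ (g (e x))) X x =
      Λ (g (e x)) * fderiv ℝ (χ ∘ e.symm) (e x) (coordExpr e X x) +
        χ x * deriv Λ (g (e x)) * fderiv ℝ g (e x) (coordExpr e X x) := by
  have hsm := contMDiff_mul_comp_chart he hχ hχe (hΛ.comp hg)
  have h1 := dirDeriv_eq_fderiv_coordExpr he hx
    ((hsm x).mdifferentiableAt (by simp)) X
  refine h1.trans ?_
  have hxt := e.map_source hx
  have heq : (fun x ↦ χ x * (Λ ∘ g) (e x)) ∘ e.symm =ᶠ[𝓝 (e x)]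
      fun y ↦ (χ ∘ e.symm) y * (Λ ∘ g) y := by
    filter_upwards [e.open_target.mem_nhds hxt] with y hy
    simp [e.right_inv hy]
  rw [heq.fderiv_eq]
  have hχd : DifferentiableAt ℝ (χ ∘ e.symm) (e x) :=
    ((contDiffOn_comp_symm he hχ).contDiffAt (e.open_target.mem_nhds hxt)).differentiableAt
      (by simp)
  have hgd : HasFDerivAt g (fderiv ℝ g (e x)) (e x) :=
    (hg.differentiable (by simp) (e x)).hasFDerivAt
  have hΛd : HasDerivAt Λ (deriv Λ (g (e x))) (g (e x)) :=
    (hΛ.differentiable (by simp) _).hasDerivAt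
  have h2 : HasFDerivAt (Λ ∘ g) (deriv Λ (g (e x)) • fderiv ℝ g (e x)) (e x) :=
    hΛd.comp_hasFDerivAt (e x) hgd
  have h3 := hχd.hasFDerivAt.mul h2
  have h4 := congrArg (fun A : EuclideanSpace ℝ (Fin m) →L[ℝ] ℝ ↦ A (coordExpr e X x)) h3.fderiv
  refine h4.trans ?_
  simp [e.left_inv hx]
  ring

variable [RiemannianBundle (fun x : M ↦ TangentSpace (𝓡 m) x)] [MeasurableSpace M] [BorelSpace M]

omit [MeasurableSpace M] [BorelSpace M] in
-- Both integrands vanish off the support of `ψ`, so the domain of integration may shrink from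
-- `e.target` to `W`.
theorem IsWeakGradient.setIntegral_pullbackForm
    {e : OpenPartialHomeomorph M (EuclideanSpace ℝ (Fin m))}
    (he : e ∈ IsManifold.maximalAtlas (𝓡 m) ∞ M) {f : M → ℝ}
    {G : ∀ x : M, TangentSpace (𝓡 m) x} (hG : IsWeakGradient f G)
    {W : Set (EuclideanSpace ℝ (Fin m))} (hWe : W ⊆ e.target)
    {ψ : EuclideanSpace ℝ (Fin m) → ℝ} (hψ : ContDiff ℝ ∞ ψ) (hψc : HasCompactSupport ψ)
    (hψW : tsupport ψ ⊆ W) (i : Fin m) :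
    ∫ y in W, f (e.symm y) * fderiv ℝ ψ y ((EuclideanSpace.basisFun (Fin m) ℝ).toBasis i) =
      -∫ y in W, pullbackForm e G y ((EuclideanSpace.basisFun (Fin m) ℝ).toBasis i) * ψ y := by
  have h := hG e he ψ hψ hψc (hψW.trans hWe) i
  have hm := e.open_target.measurableSet
  rw [setIntegral_eq_of_subset_of_forall_sdiff_eq_zero hm hWe,
    setIntegral_eq_of_subset_of_forall_sdiff_eq_zero hm hWe] at h
  · simpa [pullbackForm_single] using h
  · intro y hy
    rw [image_eq_zero_of_notMem_tsupport fun h' ↦ hy.2 (hψW h'), mul_zero]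
  · intro y hy
    have h0 : fderiv ℝ ψ y = 0 := by
      by_contra hne
      exact hy.2 (hψW (support_fderiv_subset ℝ hne))
    rw [h0, zero_apply, mul_zero]

end Localization

theorem eLpNorm_sub_self {α F : Type*} [MeasurableSpace α] [NormedAddCommGroup F] (w : α → F)
    (r : ℝ≥0∞) (ν : Measure α) : eLpNorm (w - w) r ν = 0 := by
  rw [sub_self, eLpNorm_zero]

/-! ### Integration by parts in one chart. -/

section Localization

variable {m : ℕ} {M : Type*} [TopologicalSpace M] [T2Space M]
  [ChartedSpace (EuclideanSpace ℝ (Fin m)) M] [IsManifold (𝓡 m) ∞ M]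
  [RiemannianBundle (fun x : M ↦ TangentSpace (𝓡 m) x)]
  [IsContinuousRiemannianBundle (EuclideanSpace ℝ (Fin m)) (fun x : M ↦ TangentSpace (𝓡 m) x)]
  [MeasurableSpace M] [BorelSpace M]

omit [IsManifold (𝓡 m) ∞ M]
  [IsContinuousRiemannianBundle (EuclideanSpace ℝ (Fin m)) (fun x : M ↦ TangentSpace (𝓡 m) x)] in
theorem IsWeakDivergence.integrable_mul {X : ∀ x : M, TangentSpace (𝓡 m) x} {dX : M → ℝ}
    (hdX : IsWeakDivergence X dX) {g : M → ℝ} (hg : Continuous g) (hgc : HasCompactSupport g) :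
    Integrable (fun x ↦ g x * dX x) (riemannianVolume m M) := by
  have h := hdX.locallyIntegrable
  have h' := h.integrable_smul_left_of_hasCompactSupport (𝕜 := ℝ) (g := g) hg hgc
  simpa only [smul_eq_mul] using h'

/-- With smooth approximations `uₙ` of `f` in coordinates, `χ · Λ(uₙ ∘ e)` is an admissible test
function; the product rule gives two terms, and all three integrals pass to the limit. The
integrability claims allow the identities to be summed over a partition of unity. -/
theorem IsChartNeighborhood.integral_mul_comp_mul_eq
    {e : OpenPartialHomeomorph M (EuclideanSpace ℝ (Fin m))} {U : Set M} {C : ℝ}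
    (h : IsChartNeighborhood e U C) {p q : ℝ} (hpq : p.HolderConjugate q)
    {f : M → ℝ} (hf : Continuous f) {G : ∀ x : M, TangentSpace (𝓡 m) x}
    (hfG : IsWeakGradient f G) (hG : MemLpLoc p G)
    (hGU : IntegrableOn (fun x ↦ ‖G x‖ ^ p) U (riemannianVolume m M))
    {X : ∀ x : M, TangentSpace (𝓡 m) x} (hX : MemLpLoc q X)
    (hXU : IntegrableOn (fun x ↦ ‖X x‖ ^ q) U (riemannianVolume m M))
    {dX : M → ℝ} (hdX : IsWeakDivergence X dX) {χ : M → ℝ}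
    (hχ : ContMDiff (𝓡 m) 𝓘(ℝ, ℝ) ∞ χ) (hχc : HasCompactSupport χ) (hχU : tsupport χ ⊆ U)
    {Λ : ℝ → ℝ} (hΛ : ContDiff ℝ ∞ Λ) {B : ℝ} (hΛB : ∀ t, ‖Λ t‖ ≤ B)
    (hΛB' : ∀ t, ‖deriv Λ t‖ ≤ B) :
    Integrable (fun x ↦ Λ (f x) * dirDeriv χ X x)
      (riemannianVolume m M) ∧
    Integrable (fun x ↦ χ x * deriv Λ (f x) * inner ℝ (G x) (X x)) (riemannianVolume m M) ∧
    ∫ x, χ x * Λ (f x) * dX x ∂(riemannianVolume m M) =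
      -(∫ x, Λ (f x) * dirDeriv χ X x ∂(riemannianVolume m M) +
        ∫ x, χ x * deriv Λ (f x) * inner ℝ (G x) (X x) ∂(riemannianVolume m M)) := by
  have he := h.mem_maximalAtlas
  set V := riemannianVolume m M with hV
  set S := tsupport χ with hS
  have hSc : IsCompact S := hχc
  have hSm : MeasurableSet S := hSc.isClosed.measurableSet
  have hSe : S ⊆ e.source := hχU.trans h.subset_source
  set ν := V.restrict S with hν
  -- Finiteness puts bounded differentials, such as that of `χ`, into `L^p(ν)`.
  have : IsFiniteMeasure ν := ⟨by
    rw [hν, Measure.restrict_apply_univ]; exact h.measure_lt_top hSc hSm hχU⟩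
  set W := e.target ∩ e.symm ⁻¹' U with hW
  have hWo : IsOpen W := e.symm.isOpen_inter_preimage h.isOpen
  set K := e.target ∩ e.symm ⁻¹' S with hK
  have hKe : e '' S = K := e.image_eq_target_inter_inv_preimage hSe
  have hKc : IsCompact K := hKe ▸ hSc.image_of_continuousOn (e.continuousOn.mono hSe)
  have hKW : K ⊆ W := inter_subset_inter_right _ (preimage_mono hχU)
  have hℓ := h.memLp_pullbackForm hpq.pos hG hGU
  have hLn : MemLp (fun x ↦ pullbackForm e G (e x)) (ENNReal.ofReal p) ν :=
    h.memLp_comp_chart hSm hχU (hℓ.mono_measure (Measure.restrict_mono_set _ hKW))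
  have hY : MemLp (coordExpr e X) (ENNReal.ofReal q) ν :=
    (h.memLp_coordExpr hpq.symm.pos hX hXU).mono_measure (Measure.restrict_mono_set _ hχU)
  have hfW : ContinuousOn (fun y ↦ f (e.symm y)) W :=
    hf.comp_continuousOn (e.continuousOn_symm.mono inter_subset_left)
  obtain ⟨u, hu, huf, huG⟩ := exists_contDiff_tendsto_of_weak_fderiv (μ := volume) hWo hKc hKW
    hpq.lt.le hfW hℓ (EuclideanSpace.basisFun (Fin m) ℝ).toBasis
    fun ψ hψ hψc hψW i ↦ hfG.setIntegral_pullbackForm he inter_subset_left hψ hψc hψW i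
  have hufS : ∀ x ∈ S, Tendsto (fun n ↦ u n (e x)) atTop (𝓝 (f x)) := by
    intro x hx
    have := huf (e x) (hKe ▸ mem_image_of_mem e hx)
    simpa only [e.left_inv (hSe hx)] using this
  obtain ⟨Bχ, hBχ⟩ : ∃ b, ∀ x, ‖χ x‖ ≤ b := hχc.exists_bound_of_continuous hχ.continuous
  have hecont : ContinuousOn e S := e.continuousOn.mono hSe
  -- the differential of the cutoff function
  set D : M → EuclideanSpace ℝ (Fin m) →L[ℝ] ℝ := fun x ↦ fderiv ℝ (χ ∘ e.symm) (e x) with hD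
  have hDc : ContinuousOn D S :=
    ((contDiffOn_comp_symm he hχ).continuousOn_fderiv_of_isOpen e.open_target (by simp)).comp
      hecont fun x hx ↦ e.map_source (hSe hx)
  obtain ⟨BD, hBD⟩ := hSc.exists_bound_of_continuousOn hDc
  have hDp : MemLp D (ENNReal.ofReal p) ν :=
    MemLp.of_bound (hDc.aestronglyMeasurable hSm) BD
      (by filter_upwards [ae_restrict_mem hSm] with x hx using hBD x hx)
  have hDX : ∀ x ∈ S, dirDeriv χ X x = D x (coordExpr e X x) :=
    fun x hx ↦ dirDeriv_eq_fderiv_coordExpr he (hSe hx)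
      ((hχ x).mdifferentiableAt (by simp)) X
  -- functions which vanish outside of the support of the cutoff function
  have hext : ∀ {F₁ F₂ : M → ℝ}, (∀ x ∈ S, F₁ x = F₂ x) → (∀ x ∉ S, F₁ x = 0) →
      (∫ x, F₁ x ∂V = ∫ x, F₂ x ∂ν) ∧ (Integrable F₂ ν → Integrable F₁ V) := by
    intro F₁ F₂ h1 h2
    refine ⟨?_, fun hi ↦ ?_⟩
    · rw [← setIntegral_eq_integral_of_forall_compl_eq_zero h2]
      exact setIntegral_congr_fun hSm h1
    · have hi' : IntegrableOn F₁ S V := IntegrableOn.congr_fun hi (fun x hx ↦ (h1 x hx).symm) hSm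
      rwa [integrableOn_iff_integrable_of_support_subset
        (Function.support_subset_iff'.2 h2)] at hi'
  have hχ0 : ∀ x ∉ S, χ x = 0 := fun x hx ↦ image_eq_zero_of_notMem_tsupport hx
  -- the three limits
  have hΛf : AEStronglyMeasurable (fun x ↦ Λ (f x)) ν :=
    (hΛ.continuous.comp hf).continuousOn.aestronglyMeasurable hSm
  have hΛ'c : Continuous (deriv Λ) := hΛ.continuous_deriv (by simp)
  have hχΛ'f : AEStronglyMeasurable (fun x ↦ χ x * deriv Λ (f x)) ν :=
    (hχ.continuous.mul (hΛ'c.comp hf)).continuousOn.aestronglyMeasurable hSm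
  have hχΛ'B : ∀ x t, ‖χ x * deriv Λ t‖ ≤ Bχ * B := fun x t ↦ by
    rw [norm_mul]
    exact mul_le_mul (hBχ x) (hΛB' t) (norm_nonneg _) ((norm_nonneg _).trans (hBχ x))
  obtain ⟨e1, i1⟩ := hext
    (F₁ := fun x ↦ Λ (f x) * dirDeriv χ X x)
    (F₂ := fun x ↦ Λ (f x) * D x (coordExpr e X x))
    (fun x hx ↦ by rw [hDX x hx])
    (fun x hx ↦ by rw [dirDeriv_eq_zero_of_notMem_tsupport hx, mul_zero])
  obtain ⟨e2, i2⟩ := hext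
    (F₁ := fun x ↦ χ x * deriv Λ (f x) * inner ℝ (G x) (X x))
    (F₂ := fun x ↦ χ x * deriv Λ (f x) * pullbackForm e G (e x) (coordExpr e X x))
    (fun x hx ↦ by rw [pullbackForm_coordExpr he G X (hSe hx)])
    (fun x hx ↦ by rw [hχ0 x hx, zero_mul, zero_mul])
  refine ⟨i1 (integrable_mul_clm_apply hpq hΛf (Eventually.of_forall fun x ↦ hΛB _) hDp hY),
    i2 (integrable_mul_clm_apply hpq hχΛ'f (Eventually.of_forall fun x ↦ hχΛ'B x _) hLn hY), ?_⟩
  rw [e1, e2]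
  set φ : ℕ → M → ℝ := fun n x ↦ χ x * Λ (u n (e x)) with hφ
  have hφs : ∀ n, ContMDiff (𝓡 m) 𝓘(ℝ, ℝ) ∞ (φ n) := fun n ↦
    contMDiff_mul_comp_chart he hχ hSe (hΛ.comp (hu n))
  have hφS : ∀ n, tsupport (φ n) ⊆ S := fun n ↦ tsupport_mul_subset_left
  have hφc : ∀ n, HasCompactSupport (φ n) := fun n ↦ hχc.mul_right
  have hueS : ∀ n, ContinuousOn (fun x ↦ u n (e x)) S := fun n ↦
    (hu n).continuous.comp_continuousOn hecont
  have lim1 : Tendsto (fun n ↦ ∫ x, φ n x * dX x ∂V) atTop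
      (𝓝 (∫ x, χ x * Λ (f x) * dX x ∂V)) := by
    have hχd : Integrable (fun x ↦ χ x * dX x) V :=
      hdX.integrable_mul hχ.continuous hχc
    refine tendsto_integral_of_dominated_convergence (fun x ↦ B * ‖χ x * dX x‖) (fun n ↦ ?_)
      (hχd.norm.const_mul B) (fun n ↦ Eventually.of_forall fun x ↦ ?_)
      (Eventually.of_forall fun x ↦ ?_)
    · exact (hdX.integrable_mul (hφs n).continuous (hφc n)).1
    · rw [hφ, norm_mul, norm_mul, norm_mul, mul_comm (‖χ x‖), mul_assoc]
      exact mul_le_mul_of_nonneg_right (hΛB _) (by positivity)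
    · by_cases hx : x ∈ S
      · exact (((hΛ.continuous.tendsto _).comp (hufS x hx)).const_mul (χ x)).mul_const _
      · simp [hφ, hχ0 x hx]
  have lim2 : Tendsto (fun n ↦ ∫ x, Λ (u n (e x)) * D x (coordExpr e X x) ∂ν) atTop
      (𝓝 (∫ x, Λ (f x) * D x (coordExpr e X x) ∂ν)) := by
    refine tendsto_integral_mul_clm_apply hpq
      (fun n ↦ (hΛ.continuous.comp_continuousOn (hueS n)).aestronglyMeasurable hSm)
      (fun n ↦ Eventually.of_forall fun x ↦ hΛB _) ?_ (fun _ ↦ hDp.1) ?_ hDp hY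
    · filter_upwards [ae_restrict_mem hSm] with x hx
      exact (hΛ.continuous.tendsto _).comp (hufS x hx)
    · exact tendsto_const_nhds.congr fun _ ↦ (eLpNorm_sub_self D _ ν).symm
  have lim3 : Tendsto (fun n ↦ ∫ x, χ x * deriv Λ (u n (e x)) *
        fderiv ℝ (u n) (e x) (coordExpr e X x) ∂ν) atTop
      (𝓝 (∫ x, χ x * deriv Λ (f x) * pullbackForm e G (e x) (coordExpr e X x) ∂ν)) := by
    have hfc : ∀ n, Continuous (fderiv ℝ (u n)) := fun n ↦ (hu n).continuous_fderiv (by simp)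
    refine tendsto_integral_mul_clm_apply (D := fun n x ↦ fderiv ℝ (u n) (e x)) hpq
      (fun n ↦ (hχ.continuous.continuousOn.mul
        (hΛ'c.comp_continuousOn (hueS n))).aestronglyMeasurable hSm)
      (fun n ↦ Eventually.of_forall fun x ↦ hχΛ'B x _) ?_
      (fun n ↦ ((hfc n).comp_continuousOn hecont).aestronglyMeasurable hSm) ?_ hLn hY
    · filter_upwards [ae_restrict_mem hSm] with x hx
      exact ((hΛ'c.tendsto _).comp (hufS x hx)).const_mul _
    -- The Friedrichs convergence is with respect to Lebesgue measure on `K`; the density bound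
    -- transfers it to `ν`.
    · have hb : ∀ n, eLpNorm ((fun x ↦ fderiv ℝ (u n) (e x)) - fun x ↦ pullbackForm e G (e x))
          (ENNReal.ofReal p) ν ≤ ENNReal.ofReal C ^ (1 / ENNReal.ofReal p).toReal *
            eLpNorm (fderiv ℝ (u n) - pullbackForm e G) (ENNReal.ofReal p)
              (volume.restrict K) := fun n ↦
        h.eLpNorm_comp_chart_le (v := fderiv ℝ (u n) - pullbackForm e G) hSm hχU
          ((hfc n).aestronglyMeasurable.sub
            (hℓ.1.mono_measure (Measure.restrict_mono_set _ hKW))) ENNReal.ofReal_ne_top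
      have hz := ENNReal.Tendsto.const_mul
        (a := ENNReal.ofReal C ^ (1 / ENNReal.ofReal p).toReal) huG
        (Or.inr (ENNReal.rpow_ne_top_of_nonneg ENNReal.toReal_nonneg ENNReal.ofReal_ne_top))
      rw [mul_zero] at hz
      exact tendsto_of_tendsto_of_tendsto_of_le_of_le tendsto_const_nhds hz
        (fun _ ↦ zero_le) hb
  have hstep : ∀ n, ∫ x, φ n x * dX x ∂V =
      -(∫ x, Λ (u n (e x)) * D x (coordExpr e X x) ∂ν +
        ∫ x, χ x * deriv Λ (u n (e x)) * fderiv ℝ (u n) (e x) (coordExpr e X x) ∂ν) := by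
    intro n
    have hd : ∫ x, φ n x * dX x ∂V = -∫ x, dirDeriv (φ n) X x ∂V :=
      hdX.integral_mul_eq (φ n) (hφs n) (hφc n)
    have hDu : ContinuousOn (fun x ↦ fderiv ℝ (u n) (e x)) S :=
      ((hu n).continuous_fderiv (by simp)).comp_continuousOn hecont
    obtain ⟨BU, hBU⟩ := hSc.exists_bound_of_continuousOn hDu
    have hDup : MemLp (fun x ↦ fderiv ℝ (u n) (e x)) (ENNReal.ofReal p) ν :=
      MemLp.of_bound (hDu.aestronglyMeasurable hSm) BU
        (by filter_upwards [ae_restrict_mem hSm] with x hx using hBU x hx)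
    have j1 : Integrable (fun x ↦ Λ (u n (e x)) * D x (coordExpr e X x)) ν :=
      integrable_mul_clm_apply hpq
        ((hΛ.continuous.comp_continuousOn (hueS n)).aestronglyMeasurable hSm)
        (Eventually.of_forall fun x ↦ hΛB _) hDp hY
    have j2 : Integrable (fun x ↦ χ x * deriv Λ (u n (e x)) *
        fderiv ℝ (u n) (e x) (coordExpr e X x)) ν :=
      integrable_mul_clm_apply hpq ((hχ.continuous.continuousOn.mul
        (hΛ'c.comp_continuousOn (hueS n))).aestronglyMeasurable hSm)
        (Eventually.of_forall fun x ↦ hχΛ'B x _) hDup hY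
    rw [hd, ← integral_add j1 j2]
    refine congrArg Neg.neg (hext (fun x hx ↦ ?_) fun x hx ↦ ?_).1
    · exact dirDeriv_mul_comp_chart he hχ hSe (hu n) hΛ X (hSe hx)
    · exact dirDeriv_eq_zero_of_notMem_tsupport (fun h' ↦ hx (hφS n h')) X
  exact tendsto_nhds_unique lim1 (((lim2.add lim3).neg).congr fun n ↦ (hstep n).symm)

end Localization

/-! ### Gluing the local identities with a partition of unity. -/

section Globalization

variable {m : ℕ} {M : Type*} [TopologicalSpace M]
  [ChartedSpace (EuclideanSpace ℝ (Fin m)) M] [IsManifold (𝓡 m) ∞ M]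

theorem dirDeriv_sum {ι : Type*} (J : Finset ι) {χ : ι → M → ℝ}
    (hχ : ∀ i, ContMDiff (𝓡 m) 𝓘(ℝ, ℝ) ∞ (χ i)) (X : ∀ x : M, TangentSpace (𝓡 m) x) (x : M) :
    dirDeriv (fun y ↦ ∑ i ∈ J, χ i y) X x = ∑ i ∈ J, dirDeriv (χ i) X x := by
  set e := chartAt (EuclideanSpace ℝ (Fin m)) x
  have he : e ∈ IsManifold.maximalAtlas (𝓡 m) ∞ M := IsManifold.chart_mem_maximalAtlas x
  have hx : x ∈ e.source := mem_chart_source _ x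
  have hs : ContMDiff (𝓡 m) 𝓘(ℝ, ℝ) ∞ (fun y ↦ ∑ i ∈ J, χ i y) :=
    contMDiff_finsetSum fun i _ ↦ hχ i
  rw [dirDeriv_eq_fderiv_coordExpr he hx ((hs x).mdifferentiableAt (by simp)) X,
    Finset.sum_congr rfl fun i _ ↦
      dirDeriv_eq_fderiv_coordExpr he hx ((hχ i x).mdifferentiableAt (by simp)) X]
  have hd : ∀ i ∈ J, DifferentiableAt ℝ (χ i ∘ e.symm) (e x) := fun i _ ↦
    ((contDiffOn_comp_symm he (hχ i)).contDiffAt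
      (e.open_target.mem_nhds (e.map_source hx))).differentiableAt (by simp)
  have h := fderiv_fun_sum (𝕜 := ℝ) hd
  refine (congrArg (fun A : EuclideanSpace ℝ (Fin m) →L[ℝ] ℝ ↦ A (coordExpr e X x)) h).trans ?_
  simp

omit [IsManifold (𝓡 m) ∞ M] in
theorem dirDeriv_eq_zero_of_eventuallyEq_const {φ : M → ℝ} {c : ℝ} {x : M}
    (h : φ =ᶠ[𝓝 x] fun _ ↦ c) (X : ∀ x : M, TangentSpace (𝓡 m) x) : dirDeriv φ X x = 0 := by
  rw [dirDeriv, h.mfderiv_eq, mfderiv_const]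
  rfl

variable [T2Space M] [SecondCountableTopology M]

/-- Subordinating the partition to `U x` intersected with the interior of a compact neighbourhood
gives compact supports; by local finiteness only finitely many of these functions are nonzero
somewhere on `K`. -/
theorem exists_finset_contMDiff_sum_eq_one {K : Set M} (hK : IsCompact K) {U : M → Set M}
    (hU : ∀ x, IsOpen (U x)) (hxU : ∀ x, x ∈ U x) :
    ∃ (J : Finset M) (χ : M → M → ℝ), (∀ i, ContMDiff (𝓡 m) 𝓘(ℝ, ℝ) ∞ (χ i)) ∧
      (∀ i, HasCompactSupport (χ i)) ∧ (∀ i, tsupport (χ i) ⊆ U i) ∧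
      ∀ x ∈ K, ∑ i ∈ J, χ i x = 1 := by
  have : LocallyCompactSpace M := ChartedSpace.locallyCompactSpace (EuclideanSpace ℝ (Fin m)) M
  choose A hAc hxA using fun x : M ↦ exists_compact_mem_nhds x
  obtain ⟨ρ, hρ⟩ := SmoothPartitionOfUnity.exists_isSubordinate (𝓡 m) hK.isClosed
    (fun x ↦ U x ∩ interior (A x)) (fun x ↦ (hU x).inter isOpen_interior)
    (fun x _ ↦ mem_iUnion_of_mem x ⟨hxU x, mem_interior_iff_mem_nhds.2 (hxA x)⟩)
  have hfin := ρ.locallyFinite.finite_nonempty_inter_compact hK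
  refine ⟨hfin.toFinset, fun i ↦ ρ i, fun i ↦ (ρ i).contMDiff, fun i ↦ ?_,
    fun i ↦ (hρ i).trans inter_subset_left, fun x hx ↦ ?_⟩
  · exact (hAc i).of_isClosed_subset (isClosed_tsupport _)
      ((hρ i).trans (inter_subset_right.trans interior_subset))
  · rw [← ρ.sum_eq_one hx]
    refine (finsum_eq_sum_of_support_subset _ fun i hi ↦ ?_).symm
    exact hfin.mem_toFinset.2 ⟨x, hi, hx⟩

variable [RiemannianBundle (fun x : M ↦ TangentSpace (𝓡 m) x)]
  [IsContinuousRiemannianBundle (EuclideanSpace ℝ (Fin m)) (fun x : M ↦ TangentSpace (𝓡 m) x)]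
  [MeasurableSpace M] [BorelSpace M]

omit [T2Space M] [SecondCountableTopology M] [BorelSpace M] in
theorem exists_isChartNeighborhood_integrableOn {w₁ w₂ : M → ℝ}
    (h₁ : LocallyIntegrable w₁ (riemannianVolume m M))
    (h₂ : LocallyIntegrable w₂ (riemannianVolume m M)) (x₀ : M) :
    ∃ (e : OpenPartialHomeomorph M (EuclideanSpace ℝ (Fin m))) (U : Set M) (C : ℝ),
      x₀ ∈ U ∧ IsChartNeighborhood e U C ∧ IntegrableOn w₁ U (riemannianVolume m M) ∧
        IntegrableOn w₂ U (riemannianVolume m M) := by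
  obtain ⟨e, U, C, hx, h⟩ := exists_isChartNeighborhood (m := m) x₀
  obtain ⟨s, hs, hsi⟩ := h₁ x₀
  obtain ⟨t, ht, hti⟩ := h₂ x₀
  refine ⟨e, U ∩ (interior s ∩ interior t), C, ⟨hx, mem_interior_iff_mem_nhds.2 hs,
    mem_interior_iff_mem_nhds.2 ht⟩, h.mono
      (h.isOpen.inter (isOpen_interior.inter isOpen_interior)) inter_subset_left, ?_, ?_⟩
  · exact hsi.mono_set fun x hx ↦ interior_subset hx.2.1
  · exact hti.mono_set fun x hx ↦ interior_subset hx.2.2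

/-- Summing the local identities, the terms with `dχᵢ` cancel because `∑ χᵢ` is constant near every
point where `Λ ∘ f` is nonzero. -/
theorem integral_comp_mul_eq {p q : ℝ} (hpq : p.HolderConjugate q) {f : M → ℝ}
    (hf : IsExhaustion f) {G : ∀ x : M, TangentSpace (𝓡 m) x} (hfG : IsWeakGradient f G)
    (hG : MemLpLoc p G) {X : ∀ x : M, TangentSpace (𝓡 m) x} (hX : MemLpLoc q X) {dX : M → ℝ}
    (hdX : IsWeakDivergence X dX) {Λ : ℝ → ℝ} (hΛ : ContDiff ℝ ∞ Λ) {B : ℝ}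
    (hΛB : ∀ t, ‖Λ t‖ ≤ B) (hΛB' : ∀ t, ‖deriv Λ t‖ ≤ B) {c : ℝ} (hΛc : ∀ t, c ≤ t → Λ t = 0) :
    ∫ x, Λ (f x) * dX x ∂(riemannianVolume m M) =
      -∫ x, deriv Λ (f x) * inner ℝ (G x) (X x) ∂(riemannianVolume m M) := by
  have hΛc' : ∀ t, c < t → deriv Λ t = 0 := fun t ht ↦ by
    have : Λ =ᶠ[𝓝 t] fun _ ↦ 0 := by
      filter_upwards [Ioi_mem_nhds ht] with s hs using hΛc s (le_of_lt hs)
    rw [this.deriv_eq, deriv_const]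
  choose e U C hxU hU hGU hXU using
    exists_isChartNeighborhood_integrableOn hG.locallyIntegrable hX.locallyIntegrable
  -- The level `c + 1` leaves room: on the open set `f < c + 1` the sum is locally 1, so its
  -- derivative vanishes, and beyond it `Λ ∘ f` is already zero.
  obtain ⟨J, χ, hχ, hχc, hχU, hχ1⟩ := exists_finset_contMDiff_sum_eq_one (m := m)
    (hf.isCompact_sublevel (c + 1)) (fun x ↦ (hU x).isOpen) hxU
  have key := fun i ↦ (hU i).integral_mul_comp_mul_eq hpq hf.continuous hfG hG (hGU i) hX (hXU i)
    hdX (hχ i) (hχc i) (hχU i) hΛ hΛB hΛB'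
  have hint : ∀ i, Integrable (fun x ↦ χ i x * Λ (f x) * dX x) (riemannianVolume m M) := fun i ↦
    hdX.integrable_mul ((hχ i).continuous.mul (hΛ.continuous.comp hf.continuous))
      (hχc i).mul_right
  have s0 : ∀ x, ∑ i ∈ J, χ i x * Λ (f x) * dX x = Λ (f x) * dX x := fun x ↦ by
    rw [← Finset.sum_mul, ← Finset.sum_mul]
    by_cases hx : f x ≤ c + 1
    · rw [hχ1 x hx, one_mul]
    · rw [hΛc _ (by linarith), mul_zero]
  have s1 : ∀ x, ∑ i ∈ J, Λ (f x) * dirDeriv (χ i) X x = 0 := fun x ↦ by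
    rw [← Finset.mul_sum, ← dirDeriv_sum J hχ X x]
    by_cases hx : f x < c + 1
    · rw [dirDeriv_eq_zero_of_eventuallyEq_const (c := 1) _ X, mul_zero]
      filter_upwards [(isOpen_Iio.preimage hf.continuous).mem_nhds hx] with y hy
      exact hχ1 y (show f y < c + 1 from hy).le
    · rw [hΛc _ (by linarith), zero_mul]
  have s2 : ∀ x, ∑ i ∈ J, χ i x * deriv Λ (f x) * inner ℝ (G x) (X x) =
      deriv Λ (f x) * inner ℝ (G x) (X x) := fun x ↦ by
    rw [← Finset.sum_mul, ← Finset.sum_mul]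
    by_cases hx : f x ≤ c + 1
    · rw [hχ1 x hx, one_mul]
    · rw [hΛc' _ (by linarith), mul_zero]
  have t0 := integral_finsetSum J fun i _ ↦ hint i
  have t1 := integral_finsetSum J fun i _ ↦ (key i).1
  have t2 := integral_finsetSum J fun i _ ↦ (key i).2.1
  simp only [s0] at t0
  simp only [s1, integral_zero] at t1
  simp only [s2] at t2
  rw [t0, t2, Finset.sum_congr rfl fun i _ ↦ (key i).2.2, Finset.sum_neg_distrib,
    Finset.sum_add_distrib, ← t1, zero_add]

end Globalization

/-! ### The limiting argument and the cutoff functions. -/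

section Cutoff

/-- Adding the negative part makes the integrand nonnegative, so Fatou applies; its truncated
integrals are at most `∫ gₖ h + ∫ N`, which converges. Once `h` is integrable it dominates every `gₖ
h`. -/
theorem integrable_and_integral_eq_zero_of_tendsto {α : Type*} [MeasurableSpace α] {μ : Measure α}
    {h : α → ℝ} (hm : AEStronglyMeasurable h μ) (hneg : Integrable (fun x ↦ max (-h x) 0) μ)
    {g : ℕ → α → ℝ} (hg0 : ∀ k x, 0 ≤ g k x) (hg1 : ∀ k x, g k x ≤ 1)
    (hgm : ∀ k, AEStronglyMeasurable (g k) μ) (hgt : ∀ x, Tendsto (fun k ↦ g k x) atTop (𝓝 1))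
    (hgi : ∀ k, Integrable (fun x ↦ g k x * h x) μ)
    (hlim : Tendsto (fun k ↦ ∫ x, g k x * h x ∂μ) atTop (𝓝 0)) :
    Integrable h μ ∧ ∫ x, h x ∂μ = 0 := by
  set N : α → ℝ := fun x ↦ max (-h x) 0 with hN
  have hPn : ∀ x, 0 ≤ h x + N x := fun x ↦ by
    have := le_max_left (-h x) 0
    simp only [hN]; linarith
  have hN0 : ∀ x, 0 ≤ N x := fun x ↦ le_max_right _ _
  have hgN : ∀ k, Integrable (fun x ↦ g k x * N x) μ := fun k ↦
    hneg.mono ((hgm k).mul hneg.1) (Eventually.of_forall fun x ↦ by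
      rw [norm_mul, Real.norm_of_nonneg (hg0 k x)]
      exact mul_le_of_le_one_left (norm_nonneg _) (hg1 k x))
  have hPi : Integrable (fun x ↦ h x + N x) μ := by
    refine ⟨hm.add hneg.1, ?_⟩
    rw [hasFiniteIntegral_iff_ofReal (Eventually.of_forall hPn)]
    have hk : ∀ k, ∫⁻ x, ENNReal.ofReal (g k x * (h x + N x)) ∂μ ≤
        ENNReal.ofReal (∫ x, g k x * h x ∂μ + ∫ x, N x ∂μ) := fun k ↦ by
      have hi : Integrable (fun x ↦ g k x * (h x + N x)) μ := by
        refine ((hgi k).add (hgN k)).congr (Eventually.of_forall fun x ↦ ?_)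
        exact (mul_add _ _ _).symm
      rw [← ofReal_integral_eq_lintegral_ofReal hi
        (Eventually.of_forall fun x ↦ mul_nonneg (hg0 k x) (hPn x))]
      refine ENNReal.ofReal_le_ofReal ?_
      simp only [mul_add]
      rw [integral_add (hgi k) (hgN k)]
      gcongr
      · exact hgN k
      · exact fun x ↦ mul_le_of_le_one_left (hN0 x) (hg1 k x)
    have hF : ∫⁻ x, liminf (fun k ↦ ENNReal.ofReal (g k x * (h x + N x))) atTop ∂μ ≤
        liminf (fun k ↦ ∫⁻ x, ENNReal.ofReal (g k x * (h x + N x)) ∂μ) atTop :=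
      lintegral_liminf_le' fun k ↦ ((hgm k).mul (hm.add hneg.1)).aemeasurable.ennreal_ofReal
    have hl : ∀ x, liminf (fun k ↦ ENNReal.ofReal (g k x * (h x + N x))) atTop =
        ENNReal.ofReal (h x + N x) := fun x ↦ by
      refine Tendsto.liminf_eq (ENNReal.tendsto_ofReal ?_)
      simpa only [one_mul] using (hgt x).mul_const (h x + N x)
    simp only [hl] at hF
    have hr : Tendsto (fun k ↦ ENNReal.ofReal (∫ x, g k x * h x ∂μ + ∫ x, N x ∂μ)) atTop
        (𝓝 (ENNReal.ofReal (0 + ∫ x, N x ∂μ))) :=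
      ENNReal.tendsto_ofReal (hlim.add_const _)
    calc _ ≤ _ := hF
      _ ≤ _ := liminf_le_liminf (Eventually.of_forall hk)
      _ = _ := hr.liminf_eq
      _ < ⊤ := ENNReal.ofReal_lt_top
  have hh : Integrable h μ :=
    (hPi.sub hneg).congr (Eventually.of_forall fun x ↦ add_sub_cancel_right _ _)
  refine ⟨hh, tendsto_nhds_unique ?_ hlim⟩
  refine tendsto_integral_of_dominated_convergence (fun x ↦ ‖h x‖) (fun k ↦ (hgi k).1) hh.norm
    (fun k ↦ Eventually.of_forall fun x ↦ ?_) (Eventually.of_forall fun x ↦ ?_)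
  · rw [norm_mul, Real.norm_of_nonneg (hg0 k x)]
    exact mul_le_of_le_one_left (norm_nonneg _) (hg1 k x)
  · simpa only [one_mul] using (hgt x).mul_const (h x)

/-- Every such point is a global minimum, which includes the endpoint `0` without one-sided limits.
-/
theorem deriv_smoothTransition_of_nonpos {s : ℝ} (hs : s ≤ 0) :
    deriv Real.smoothTransition s = 0 := by
  refine IsLocalMin.deriv_eq_zero (Eventually.of_forall fun t ↦ ?_)
  rw [Real.smoothTransition.zero_of_nonpos hs]
  exact Real.smoothTransition.nonneg t

theorem deriv_smoothTransition_of_one_le {s : ℝ} (hs : 1 ≤ s) :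
    deriv Real.smoothTransition s = 0 := by
  refine IsLocalMax.deriv_eq_zero (Eventually.of_forall fun t ↦ ?_)
  rw [Real.smoothTransition.one_of_one_le hs]
  exact Real.smoothTransition.le_one t

theorem exists_norm_deriv_smoothTransition_le :
    ∃ B : ℝ, 0 ≤ B ∧ ∀ s, ‖deriv Real.smoothTransition s‖ ≤ B := by
  have hc : Continuous (deriv Real.smoothTransition) :=
    (Real.smoothTransition.contDiff (n := 1)).continuous_deriv (by simp)
  obtain ⟨B, hB⟩ := (isCompact_Icc (a := (0 : ℝ)) (b := 1)).exists_bound_of_continuousOn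
    hc.continuousOn
  have hB0 : 0 ≤ B := (norm_nonneg _).trans (hB 0 ⟨le_rfl, zero_le_one⟩)
  refine ⟨B, hB0, fun s ↦ ?_⟩
  by_cases h0 : s ≤ 0
  · simpa [deriv_smoothTransition_of_nonpos h0] using hB0
  by_cases h1 : 1 ≤ s
  · simpa [deriv_smoothTransition_of_one_le h1] using hB0
  · exact hB s ⟨le_of_not_ge h0, le_of_not_ge h1⟩

/-- A smooth function on the line, equal to `1` on `(-∞, r]` and to `0` on `[2r, ∞)`. -/
def cutoff (r t : ℝ) : ℝ := Real.smoothTransition (2 - t / r)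

theorem contDiff_cutoff (r : ℝ) : ContDiff ℝ ∞ (cutoff r) :=
  Real.smoothTransition.contDiff.comp (contDiff_const.sub (contDiff_id.div_const r))

theorem cutoff_of_le {r t : ℝ} (hr : 0 < r) (h : t ≤ r) : cutoff r t = 1 :=
  Real.smoothTransition.one_of_one_le (by
    have := (div_le_one hr).2 h
    linarith)

theorem cutoff_of_two_mul_le {r t : ℝ} (hr : 0 < r) (h : 2 * r ≤ t) : cutoff r t = 0 :=
  Real.smoothTransition.zero_of_nonpos (by
    have := (le_div_iff₀ hr).2 h
    linarith)

theorem deriv_cutoff (r t : ℝ) :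
    deriv (cutoff r) t = deriv Real.smoothTransition (2 - t / r) * (-(1 / r)) := by
  have h1 : HasDerivAt (fun t : ℝ ↦ 2 - t / r) (-(1 / r)) t :=
    ((hasDerivAt_id t).div_const r).const_sub 2
  have h2 : HasDerivAt Real.smoothTransition (deriv Real.smoothTransition (2 - t / r))
      (2 - t / r) :=
    ((Real.smoothTransition.contDiff (n := 1)).differentiable (by simp) _).hasDerivAt
  exact (h2.comp t h1).deriv

/-- The derivative also vanishes at `2 * r`, so the half-open interval of the shell suffices. -/
theorem deriv_cutoff_eq_zero {r t : ℝ} (hr : 0 < r) (h : t ∉ Ico r (2 * r)) :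
    deriv (cutoff r) t = 0 := by
  rw [deriv_cutoff]
  by_cases h1 : t < r
  · have := (div_lt_one hr).2 h1
    rw [deriv_smoothTransition_of_one_le (by linarith), zero_mul]
  · have h2 : 2 * r ≤ t := by
      by_contra h2
      exact h ⟨not_lt.1 h1, not_le.1 h2⟩
    have := (le_div_iff₀ hr).2 h2
    rw [deriv_smoothTransition_of_nonpos (by linarith), zero_mul]

theorem shell_eq {M : Type*} [TopologicalSpace M] {f : M → ℝ} (hf : ∀ x, 0 ≤ f x) (r : ℝ) :
    shell f r = f ⁻¹' Ico r (2 * r) := by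
  ext x
  have := hf x
  simp only [shell, Set.mem_sdiff, mem_preimage, mem_Ico, this, true_and, not_lt]
  tauto

end Cutoff

/-! ### The estimate on shells and the conclusion. -/

section Final

variable {m : ℕ} {M : Type*} [TopologicalSpace M] [T2Space M] [SecondCountableTopology M]
  [ChartedSpace (EuclideanSpace ℝ (Fin m)) M] [IsManifold (𝓡 m) ∞ M]
  [MeasurableSpace M] [BorelSpace M]
  [RiemannianBundle (fun x : M ↦ TangentSpace (𝓡 m) x)]

omit [T2Space M] [IsManifold (𝓡 m) ∞ M] [BorelSpace M] in
-- Measurability of the norm is recovered globally as a root of `‖X‖ ^ p`, which avoids patching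
-- charts.
theorem MemLpLoc.aemeasurable_norm {p : ℝ} (hp : p ≠ 0) {X : ∀ x : M, TangentSpace (𝓡 m) x}
    (hX : MemLpLoc p X) : AEMeasurable (fun x ↦ ‖X x‖) (riemannianVolume m M) := by
  have h := hX.locallyIntegrable.aestronglyMeasurable.aemeasurable.pow_const p⁻¹
  refine h.congr (Eventually.of_forall fun x ↦ ?_)
  exact Real.rpow_rpow_inv (norm_nonneg _) hp

variable [IsContinuousRiemannianBundle (EuclideanSpace ℝ (Fin m))
  (fun x : M ↦ TangentSpace (𝓡 m) x)]

theorem enorm_integral_cutoff_mul_le {p q : ℝ} (hpq : p.HolderConjugate q) {f : M → ℝ}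
    (hf : IsExhaustion f) {G : ∀ x : M, TangentSpace (𝓡 m) x} (hfG : IsWeakGradient f G)
    (hG : MemLpLoc p G) {X : ∀ x : M, TangentSpace (𝓡 m) x} (hX : MemLpLoc q X) {dX : M → ℝ}
    (hdX : IsWeakDivergence X dX) {B : ℝ} (hB0 : 0 ≤ B)
    (hB : ∀ s, ‖deriv Real.smoothTransition s‖ ≤ B) {r : ℝ} (hr : 0 < r) :
    ‖∫ x, cutoff r (f x) * dX x ∂(riemannianVolume m M)‖ₑ ≤ ENNReal.ofReal B *
      (ENNReal.ofReal (1 / r) *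
        (∫⁻ x in shell f r, ENNReal.ofReal (‖G x‖ ^ p) ∂(riemannianVolume m M)) ^ (1 / p) *
        (∫⁻ x in shell f r, ENNReal.ofReal (‖X x‖ ^ q) ∂(riemannianVolume m M)) ^ (1 / q)) := by
  have hB' : ∀ t, ‖deriv (cutoff r) t‖ ≤ B * (1 / r) := fun t ↦ by
    rw [deriv_cutoff, norm_mul, norm_neg, Real.norm_of_nonneg (by positivity : 0 ≤ 1 / r)]
    exact mul_le_mul_of_nonneg_right (hB _) (by positivity)
  -- `integral_comp_mul_eq` asks for one bound on both `Λ` and `Λ'`. It does not enter the estimate,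
  -- where the sharper `B * (1 / r)` is used.
  have hc1 : ∀ t, ‖cutoff r t‖ ≤ max 1 (B * (1 / r)) := fun t ↦ by
    refine le_max_of_le_left ?_
    rw [cutoff, Real.norm_of_nonneg (Real.smoothTransition.nonneg _)]
    exact Real.smoothTransition.le_one _
  rw [integral_comp_mul_eq hpq hf hfG hG hX hdX (contDiff_cutoff r) hc1
    (fun t ↦ (hB' t).trans (le_max_right _ _)) fun t ↦ cutoff_of_two_mul_le hr, enorm_neg]
  set V := riemannianVolume m M
  have hSm : MeasurableSet (shell f r) := by
    rw [shell_eq hf.nonneg]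
    exact hf.continuous.measurable measurableSet_Ico
  have hGm := (hG.aemeasurable_norm hpq.ne_zero).ennreal_ofReal.restrict (s := shell f r)
  have hXm := (hX.aemeasurable_norm hpq.symm.ne_zero).ennreal_ofReal.restrict (s := shell f r)
  have hpt : ∀ x, ‖deriv (cutoff r) (f x) * inner ℝ (G x) (X x)‖ₑ ≤
      (shell f r).indicator (fun x ↦ ENNReal.ofReal (B * (1 / r)) *
        (ENNReal.ofReal ‖G x‖ * ENNReal.ofReal ‖X x‖)) x := fun x ↦ by
    by_cases hx : x ∈ shell f r
    · rw [indicator_of_mem hx, ← ENNReal.ofReal_mul (norm_nonneg _),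
        ← ENNReal.ofReal_mul (by positivity), ← ofReal_norm]
      refine ENNReal.ofReal_le_ofReal ?_
      rw [norm_mul]
      exact mul_le_mul (hB' _) (norm_inner_le_norm _ _) (norm_nonneg _) (by positivity)
    · have hx' : f x ∉ Ico r (2 * r) := by rwa [shell_eq hf.nonneg] at hx
      rw [deriv_cutoff_eq_zero hr hx', zero_mul, enorm_zero]
      exact zero_le
  calc ‖∫ x, deriv (cutoff r) (f x) * inner ℝ (G x) (X x) ∂V‖ₑ
      ≤ ∫⁻ x, ‖deriv (cutoff r) (f x) * inner ℝ (G x) (X x)‖ₑ ∂V :=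
        enorm_integral_le_lintegral_enorm _
    _ ≤ ∫⁻ x, (shell f r).indicator (fun x ↦ ENNReal.ofReal (B * (1 / r)) *
        (ENNReal.ofReal ‖G x‖ * ENNReal.ofReal ‖X x‖)) x ∂V := lintegral_mono hpt
    _ = ENNReal.ofReal (B * (1 / r)) *
        ∫⁻ x in shell f r, ENNReal.ofReal ‖G x‖ * ENNReal.ofReal ‖X x‖ ∂V := by
        rw [lintegral_indicator hSm, lintegral_const_mul' _ _ ENNReal.ofReal_ne_top]
    _ ≤ ENNReal.ofReal (B * (1 / r)) *
        ((∫⁻ x in shell f r, ENNReal.ofReal ‖G x‖ ^ p ∂V) ^ (1 / p) *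
        (∫⁻ x in shell f r, ENNReal.ofReal ‖X x‖ ^ q ∂V) ^ (1 / q)) :=
        mul_le_mul_right (ENNReal.lintegral_mul_le_Lp_mul_Lq _ hpq hGm hXm) _
    _ = _ := by
        simp only [ENNReal.ofReal_rpow_of_nonneg (norm_nonneg _) hpq.nonneg,
          ENNReal.ofReal_rpow_of_nonneg (norm_nonneg _) hpq.symm.nonneg]
        rw [ENNReal.ofReal_mul hB0]
        ring

theorem integrable_and_integral_divergence_eq_zero {p q : ℝ} (hpq : p.HolderConjugate q)
    {f : M → ℝ} (hf : IsExhaustion f) {G : ∀ x : M, TangentSpace (𝓡 m) x}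
    (hfG : IsWeakGradient f G) (hG : MemLpLoc p G) {X : ∀ x : M, TangentSpace (𝓡 m) x}
    (hX : MemLpLoc q X) {dX : M → ℝ} (hdX : IsWeakDivergence X dX)
    (hneg : Integrable (fun x ↦ max (-dX x) 0) (riemannianVolume m M))
    (hE : ConditionE p q f G X) :
    Integrable dX (riemannianVolume m M) ∧ ∫ x, dX x ∂(riemannianVolume m M) = 0 := by
  obtain ⟨B, hB0, hB⟩ := exists_norm_deriv_smoothTransition_le
  have hr : ∀ k : ℕ, ∃ r : ℝ, (k : ℝ) + 1 ≤ r ∧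
      ‖∫ x, cutoff r (f x) * dX x ∂(riemannianVolume m M)‖ ≤ B * (1 / ((k : ℝ) + 1)) := by
    intro k
    have hk : (0 : ℝ) < 1 / ((k : ℝ) + 1) := by positivity
    have hlt := (hE : _ = _).trans_lt (ENNReal.ofReal_pos.2 hk)
    -- A zero lower limit gives small values only for arbitrarily large `r`, so a sequence of radii
    -- with `r k ≥ k + 1` is selected; its divergence makes the cutoffs tend to 1 pointwise.
    obtain ⟨r, h1, h2⟩ :=
      ((frequently_lt_of_liminf_lt (by isBoundedDefault) hlt).and_eventually
        (eventually_ge_atTop ((k : ℝ) + 1))).exists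
    have hr0 : 0 < r := lt_of_lt_of_le (by positivity) h2
    refine ⟨r, h2, ?_⟩
    have h3 := (enorm_integral_cutoff_mul_le hpq hf hfG hG hX hdX hB0 hB hr0).trans
      (mul_le_mul_right h1.le _)
    rwa [← ENNReal.ofReal_mul hB0, ← ofReal_norm,
      ENNReal.ofReal_le_ofReal_iff (by positivity)] at h3
  choose r hkr hrI using hr
  have hr0 : ∀ k, 0 < r k := fun k ↦ lt_of_lt_of_le (by positivity) (hkr k)
  have hcont : ∀ k, Continuous (fun x ↦ cutoff (r k) (f x)) := fun k ↦
    (contDiff_cutoff (r k)).continuous.comp hf.continuous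
  refine integrable_and_integral_eq_zero_of_tendsto
    (g := fun k x ↦ cutoff (r k) (f x)) hdX.locallyIntegrable.aestronglyMeasurable hneg
    (fun k x ↦ Real.smoothTransition.nonneg _) (fun k x ↦ Real.smoothTransition.le_one _)
    (fun k ↦ (hcont k).aestronglyMeasurable) (fun x ↦ ?_) (fun k ↦ ?_) ?_
  · refine tendsto_const_nhds.congr' ?_
    obtain ⟨n, hn⟩ := exists_nat_ge (f x)
    filter_upwards [eventually_ge_atTop n] with k hk
    have hk' : (n : ℝ) ≤ k := Nat.cast_le.2 hk
    exact (cutoff_of_le (hr0 k) (by linarith [hkr k])).symm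
  · refine hdX.integrable_mul (hcont k)
      (HasCompactSupport.intro (hf.isCompact_sublevel (2 * r k)) fun x hx ↦ ?_)
    exact cutoff_of_two_mul_le (hr0 k) (le_of_not_ge hx)
  · refine squeeze_zero_norm hrI ?_
    simpa only [mul_zero] using tendsto_one_div_add_atTop_nhds_zero_nat.const_mul B

end Final

end KarpStokes

end

theorem mainTheorem3 {m : ℕ} {M : Type*} [TopologicalSpace M] [T2Space M]
    [SecondCountableTopology M] [ChartedSpace (EuclideanSpace ℝ (Fin m)) M]
    [IsManifold (𝓡 m) ∞ M] [MeasurableSpace M] [BorelSpace M]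
    [RiemannianBundle (fun x : M ↦ TangentSpace (𝓡 m) x)]
    [IsContMDiffRiemannianBundle (𝓡 m) ∞ (EuclideanSpace ℝ (Fin m))
      (fun x : M ↦ TangentSpace (𝓡 m) x)]
    (p q : ℝ) (hpq : p.HolderConjugate q)
    (f : M → ℝ) (gradf : ∀ x : M, TangentSpace (𝓡 m) x)
    (hf : KarpStokes.IsExhaustion f) (hfp : KarpStokes.IsSobolevLoc p f gradf)
    (X : ∀ x : M, TangentSpace (𝓡 m) x) (hX : KarpStokes.MemLpLoc q X)
    (divX : M → ℝ) (hdiv : KarpStokes.IsWeakDivergence X divX)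
    (hneg : Integrable (fun x ↦ max (-divX x) 0) (KarpStokes.riemannianVolume m M))
    (hE : KarpStokes.ConditionE p q f gradf X) :
    Integrable divX (KarpStokes.riemannianVolume m M) ∧
      ∫ x, divX x ∂(KarpStokes.riemannianVolume m M) = 0 := by
  have := KarpStokes.isContinuousRiemannianBundle_tangent (m := m) (M := M)
  exact KarpStokes.integrable_and_integral_divergence_eq_zero hpq hf hfp.isWeakGradient hfp.memLpLoc
    hX hdiv hneg hE
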